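/- Let $n\ge 1$. Let $F_n^\infty$ be the noncommutative Hardy algebra, i.e. the closure, in the weak operator topology, of the unital algebra generated by the left creation operators $S_1,\dots,S_n$ on the full Fock space of $\mathbb{C}^n$; its weak* topology is the restriction of the weak operator topology. For $z$ in the open unit ball $\mathbb{B}_n$ of $\mathbb{C}^n$ and $\varphi\in F_n^\infty$, let $\varphi(z)$ be the value at $\varphi$ of the weak* continuous unital algebra homomorphism $F_n^\infty\to\mathbb{C}$ with $S_j\mapsto z_j$. For $\Delta\subseteq\mathbb{B}_n$ put $\mathcal{N}_\Delta=\{\varphi\in F_n^\infty:\varphi(z)=0\ \forall z\in\Delta\}$. The quotient $F_n^\infty/\mathcal{N}_\Delta$ carries its weak* topology as the dual of the polar of $\mathcal{N}_\Delta$ in the predual of $F_n^\infty$ and the quotient matrix norms of $M_k(F_n^\infty/\mathcal{N}_\Delta)=M_k(F_n^\infty)/M_k(\mathcal{N}_\Delta)$, $k\ge 1$; its elements $a$ have well-defined values $a(z)$ at the points $z\in\Delta$. Let $\operatorname{Aut}(F_n^\infty/\mathcal{N}_\Delta)$ be the set of weak* continuous, completely isometric algebra automorphisms of $F_n^\infty/\mathcal{N}_\Delta$.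 The group $SU(n,1)$ of complex $(n+1)\times(n+1)$ matrices of determinant one that preserve the form $\sum_{j\le n}\overline{v_j}w_j-\overline{v_{n+1}}w_{n+1}$ acts on $\mathbb{B}_n$ by fractional linear maps. Let $\Gamma$ be a discrete subgroup of $SU(n,1)$ such that $$\sum_{\gamma\in\Gamma}\bigl(1-\|\gamma(0)\|_{\mathbb{C}^n}\bigr)<\infty$$ and such that the orbit $\Gamma(0)$ of $0$ spans $\mathbb{C}^n$. Then the set $\underline{\Gamma}=\{\gamma\in SU(n,1):\gamma(z)\in\Gamma(0)\ \forall z\in\Gamma(0)\}$ equals the setwise stabilizer $\{\gamma\in SU(n,1):\gamma(\Gamma(0))=\Gamma(0)\}$, a subgroup of $SU(n,1)$, and $\operatorname{Aut}(F_n^\infty/\mathcal{N}_{\Gamma(0)})$ is a group, isomorphic to $\underline{\Gamma}$ as a group of transformations of $\mathbb{B}_n$: there is a group homomorphism $\tau$ from $\underline{\Gamma}$ onto $\operatorname{Aut}(F_n^\infty/\mathcal{N}_{\Gamma(0)})$, whose kernel consists of the elements of $\underline{\Gamma}$ that act trivially on $\mathbb{B}_n$, such that $$\tau(\gamma)(a)(\gamma(z))=a(z)\qquad(\gamma\in\underline{\Gamma},\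 a\in F_n^\infty/\mathcal{N}_{\Gamma(0)},\ z\in\Gamma(0)).$$ Moreover, the action of $\Gamma\subseteq\underline{\Gamma}$ on $F_n^\infty/\mathcal{N}_{\Gamma(0)}$ through $\tau$ is ergodic: if $\tau(\gamma)(a)=a$ for all $\gamma\in\Gamma$, then $a$ is a scalar multiple of the identity. -/

import Mathlib

noncomputable section

namespace NCHardy

open scoped ENNReal InnerProductSpace ComplexConjugate Pointwise Topology

/-! ### The unit ball and the group `SU(n,1)` -/

/-- The open unit ball of `ℂⁿ` for the Hermitian norm. -/
abbrev Ball (n : ℕ) : Type := Metric.ball (0 : EuclideanSpace ℂ (Fin n)) 1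

/-- The origin, as a point of the ball. -/
def Ball.origin (n : ℕ) : Ball n := ⟨0, by simp⟩

/-- The complex `(n+1) × (n+1)` matrices. -/
abbrev Mat (n : ℕ) : Type := Matrix (Fin n ⊕ Unit) (Fin n ⊕ Unit) ℂ

/-- The Gram matrix `diag(1, …, 1, -1)` of the sesquilinear form
`∑ conj vⱼ wⱼ - conj vₙ₊₁ wₙ₊₁` on `ℂⁿ⁺¹`. -/
def formMatrix (n : ℕ) : Mat n :=
  Matrix.diagonal (Sum.elim (fun _ => 1) (fun _ => -1))

/-- `SU(n,1)`: the complex `(n+1) × (n+1)` matrices of determinant one that preserve the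
sesquilinear form. It carries the topology of a space of matrices. -/
def SU (n : ℕ) : Subgroup (Matrix.SpecialLinearGroup (Fin n ⊕ Unit) ℂ) where
  carrier := {g | (g : Mat n).conjTranspose * formMatrix n * (g : Mat n) = formMatrix n}
  one_mem' := by simp
  mul_mem' := by
    intro a b ha hb
    simp only [Set.mem_ofPred_eq, Matrix.SpecialLinearGroup.coe_mul,
      Matrix.conjTranspose_mul] at ha hb ⊢
    calc (b : Mat n).conjTranspose * (a : Mat n).conjTranspose * formMatrix n * ((a : Mat n) * (b : Mat n))
        = (b : Mat n).conjTranspose * ((a : Mat n).conjTranspose * formMatrix n * (a : Mat n)) * (b : Mat n) := by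
          simp only [Matrix.mul_assoc]
      _ = formMatrix n := by rw [ha, hb]
  inv_mem' := by
    intro a ha
    simp only [Set.mem_ofPred_eq] at ha ⊢
    have h1 : (a : Mat n) * (↑(a⁻¹) : Mat n) = 1 := by
      rw [← Matrix.SpecialLinearGroup.coe_mul, mul_inv_cancel, Matrix.SpecialLinearGroup.coe_one]
    have h2 : (↑(a⁻¹) : Mat n).conjTranspose * (a : Mat n).conjTranspose = 1 := by
      rw [← Matrix.conjTranspose_mul, h1, Matrix.conjTranspose_one]
    calc (↑(a⁻¹) : Mat n).conjTranspose * formMatrix n * (↑(a⁻¹) : Mat n)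
        = (↑(a⁻¹) : Mat n).conjTranspose * ((a : Mat n).conjTranspose * formMatrix n * (a : Mat n)) * (↑(a⁻¹) : Mat n) := by
          rw [ha]
      _ = ((↑(a⁻¹) : Mat n).conjTranspose * (a : Mat n).conjTranspose) * formMatrix n * ((a : Mat n) * (↑(a⁻¹) : Mat n)) := by
          simp only [Matrix.mul_assoc]
      _ = formMatrix n := by rw [h1, h2, Matrix.one_mul, Matrix.mul_one]

/-- The matrix of an element of `SU(n,1)`. -/
def toMat {n : ℕ} (γ : SU n) : Mat n := ↑γ.1

/-- The vector `(z, 1)` of `ℂⁿ⁺¹`. -/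
def homog {n : ℕ} (z : EuclideanSpace ℂ (Fin n)) : Fin n ⊕ Unit → ℂ :=
  Sum.elim (fun i => z i) (fun _ => 1)

/-- The last coordinate of `γ (z, 1)`. -/
def denom {n : ℕ} (γ : SU n) (z : EuclideanSpace ℂ (Fin n)) : ℂ :=
  (toMat γ).mulVec (homog z) (Sum.inr ())

/-- The fractional linear map of `γ`: the first `n` coordinates of `γ (z, 1)` divided by the
last one. -/
def moebius {n : ℕ} (γ : SU n) (z : EuclideanSpace ℂ (Fin n)) : EuclideanSpace ℂ (Fin n) :=
  WithLp.toLp 2 fun i => (toMat γ).mulVec (homog z) (Sum.inl i) / denom γ z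

theorem form_apply {n : ℕ} (v : Fin n ⊕ Unit → ℂ) :
    star v ⬝ᵥ (formMatrix n).mulVec v =
      ((∑ i, ‖v (Sum.inl i)‖ ^ 2 - ‖v (Sum.inr ())‖ ^ 2 : ℝ) : ℂ) := by
  simp only [formMatrix, Matrix.mulVec_diagonal, dotProduct, Fintype.sum_sum_type, Pi.star_apply,
    Sum.elim_inl, Sum.elim_inr, RCLike.star_def, one_mul, Finset.univ_unique, Finset.sum_singleton]
  push_cast
  simp only [← Complex.conj_mul']
  simp [sub_eq_add_neg]

theorem form_preserved {n : ℕ} (γ : SU n) (v : Fin n ⊕ Unit → ℂ) :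
    ∑ i, ‖(toMat γ).mulVec v (Sum.inl i)‖ ^ 2 - ‖(toMat γ).mulVec v (Sum.inr ())‖ ^ 2 =
      ∑ i, ‖v (Sum.inl i)‖ ^ 2 - ‖v (Sum.inr ())‖ ^ 2 := by
  have h : (toMat γ).conjTranspose * formMatrix n * (toMat γ) = formMatrix n := γ.2
  have := form_apply ((toMat γ).mulVec v)
  rw [Matrix.star_mulVec, ← Matrix.dotProduct_mulVec, Matrix.mulVec_mulVec, Matrix.mulVec_mulVec,
    h, form_apply] at this
  exact_mod_cast this.symm

theorem norm_lt_denom {n : ℕ} (γ : SU n) (z : Ball n) :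
    ∑ i, ‖(toMat γ).mulVec (homog z.1) (Sum.inl i)‖ ^ 2 < ‖denom γ z.1‖ ^ 2 := by
  have h := form_preserved γ (homog z.1)
  have hz : ‖z.1‖ < 1 := mem_ball_zero_iff.1 z.2
  have hz2 : ∑ i, ‖z.1 i‖ ^ 2 < 1 := by
    rw [← EuclideanSpace.norm_sq_eq]
    nlinarith [norm_nonneg z.1]
  simp only [homog, Sum.elim_inl, Sum.elim_inr, norm_one] at h
  simp only [denom]
  change ∑ i, ‖(toMat γ).mulVec (homog z.1) (Sum.inl i)‖ ^ 2 -
    ‖(toMat γ).mulVec (homog z.1) (Sum.inr ())‖ ^ 2 = _ at h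
  linarith

theorem denom_ne_zero {n : ℕ} (γ : SU n) (z : Ball n) : denom γ z.1 ≠ 0 := by
  intro h0
  have h := norm_lt_denom γ z
  rw [h0] at h
  have : 0 ≤ ∑ i, ‖(toMat γ).mulVec (homog z.1) (Sum.inl i)‖ ^ 2 := by positivity
  simp at h
  linarith

theorem moebius_mem {n : ℕ} (γ : SU n) (z : Ball n) :
    moebius γ z.1 ∈ Metric.ball (0 : EuclideanSpace ℂ (Fin n)) 1 := by
  have h := norm_lt_denom γ z
  have hd : 0 < ‖denom γ z.1‖ ^ 2 := by
    have := norm_pos_iff.2 (denom_ne_zero γ z)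
    positivity
  rw [mem_ball_zero_iff, ← sq_lt_one_iff₀ (norm_nonneg _), EuclideanSpace.norm_sq_eq]
  simp only [moebius, norm_div, div_pow]
  rw [← Finset.sum_div, div_lt_one hd]
  exact h

theorem homog_moebius {n : ℕ} (γ : SU n) (z : Ball n) :
    (toMat γ).mulVec (homog z.1) = denom γ z.1 • homog (moebius γ z.1) := by
  have hd := denom_ne_zero γ z
  funext i
  rcases i with i | i
  · simp only [homog, moebius, Pi.smul_apply, Sum.elim_inl, smul_eq_mul]
    field_simp
  · simp [homog, denom]

/-- `SU(n,1)` acts on the ball by fractional linear maps. -/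
instance (n : ℕ) : MulAction (SU n) (Ball n) where
  smul γ z := ⟨moebius γ z.1, moebius_mem γ z⟩
  one_smul z := by
    apply Subtype.ext
    change moebius 1 z.1 = z.1
    ext i
    simp [moebius, denom, homog, toMat]
  mul_smul a b z := by
    apply Subtype.ext
    change moebius (a * b) z.1 = moebius a (moebius b z.1)
    have hb := denom_ne_zero b z
    have key : (toMat (a * b)).mulVec (homog z.1) =
        denom b z.1 • (toMat a).mulVec (homog (moebius b z.1)) := by
      rw [← Matrix.mulVec_smul, ← homog_moebius, Matrix.mulVec_mulVec]
      simp [toMat]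
    ext i
    simp only [moebius]
    rw [denom, key]
    simp only [Pi.smul_apply, smul_eq_mul]
    rw [mul_div_mul_left _ _ hb]
    rfl

/-- The orbit `Γ(0)`. -/
def orbit {n : ℕ} (Γ : Subgroup (SU n)) : Set (Ball n) :=
  MulAction.orbit Γ (Ball.origin n)

/-- The stabilizer in `SU(n,1)` of the set `Γ(0)`. -/
def orbitStabilizer {n : ℕ} (Γ : Subgroup (SU n)) : Subgroup (SU n) :=
  MulAction.stabilizer (SU n) (orbit Γ)

theorem le_orbitStabilizer {n : ℕ} (Γ : Subgroup (SU n)) : Γ ≤ orbitStabilizer Γ := by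
  intro γ hγ
  exact MulAction.smul_orbit (⟨γ, hγ⟩ : Γ) (Ball.origin n)

theorem smul_mem_orbit {n : ℕ} {Γ : Subgroup (SU n)} (γ : orbitStabilizer Γ) {z : Ball n}
    (hz : z ∈ orbit Γ) : γ.1 • z ∈ orbit Γ := by
  have h : γ.1 • orbit Γ = orbit Γ := γ.2
  rw [← h]
  exact Set.smul_mem_smul_set hz

/-! ### The full Fock space and the noncommutative Hardy algebra -/

/-- The full Fock space of `ℂⁿ`, in coordinates: square summable families indexed by the words in
`n` letters, the word `[i₁, …, iₘ]` standing for `e_{i₁} ⊗ ⋯ ⊗ e_{iₘ}` and `[]` for the vacuum. -/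
abbrev Fock (n : ℕ) : Type := lp (fun _ : List (Fin n) => ℂ) 2

/-- The vacuum vector. -/
def vacuum (n : ℕ) : Fock n := lp.single 2 [] 1

/-- The coordinates of `e_j ⊗ f`. -/
def shiftFun {n : ℕ} (j : Fin n) (f : List (Fin n) → ℂ) : List (Fin n) → ℂ
  | [] => 0
  | i :: w => if i = j then f w else 0

theorem shiftFun_eq_extend {n : ℕ} (j : Fin n) (f : List (Fin n) → ℂ) :
    shiftFun j f = Function.extend (fun w => j :: w) f 0 := by
  have hinj : Function.Injective (fun w : List (Fin n) => j :: w) := List.cons_injective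
  funext w
  by_cases h : ∃ v, j :: v = w
  · obtain ⟨v, rfl⟩ := h
    rw [hinj.extend_apply]
    simp [shiftFun]
  · rw [Function.extend_apply' _ _ _ h]
    rcases w with _ | ⟨i, w⟩
    · rfl
    · have : i ≠ j := by
        rintro rfl
        exact h ⟨w, rfl⟩
      simp [shiftFun, this]

theorem hasSum_shiftFun {n : ℕ} (j : Fin n) (f : List (Fin n) → ℂ) {a : ℝ}
    (h : HasSum (fun w => ‖f w‖ ^ 2) a) : HasSum (fun w => ‖shiftFun j f w‖ ^ 2) a := by
  have hinj : Function.Injective (fun w : List (Fin n) => j :: w) := List.cons_injective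
  have e : (fun w => ‖shiftFun j f w‖ ^ 2) =
      Function.extend (fun w => j :: w) (fun w => ‖f w‖ ^ 2) 0 := by
    funext w
    rw [shiftFun_eq_extend]
    by_cases h : ∃ v, j :: v = w
    · obtain ⟨v, rfl⟩ := h
      rw [hinj.extend_apply, hinj.extend_apply]
    · rw [Function.extend_apply' _ _ _ h, Function.extend_apply' _ _ _ h]
      simp
  rw [e]
  exact (hasSum_extend_zero hinj).2 h

theorem fock_hasSum {n : ℕ} (f : Fock n) : HasSum (fun w => ‖f w‖ ^ 2) (‖f‖ ^ 2) := by
  have := lp.hasSum_norm (p := 2) (by norm_num) f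
  simpa using this

theorem memlp_two {n : ℕ} {f : List (Fin n) → ℂ} (h : Summable fun w => ‖f w‖ ^ 2) :
    Memℓp f 2 := by
  apply memℓp_gen
  simpa using h

/-- The left creation operator `S_j : f ↦ e_j ⊗ f`. -/
def creation {n : ℕ} (j : Fin n) : Fock n →L[ℂ] Fock n :=
  LinearMap.mkContinuous
    { toFun := fun f => ⟨shiftFun j f, memlp_two (hasSum_shiftFun j _ (fock_hasSum f)).summable⟩
      map_add' := by
        intro f g
        ext w
        rcases w with _ | ⟨i, w⟩
        · change (0 : ℂ) = 0 + 0
          simp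
        · change (if i = j then f w + g w else 0) =
            (if i = j then f w else 0) + (if i = j then g w else 0)
          split_ifs <;> simp
      map_smul' := by
        intro c f
        ext w
        rcases w with _ | ⟨i, w⟩
        · simp [shiftFun]
        · by_cases h : i = j <;> simp [shiftFun, h] }
    1 (by
      intro f
      rw [one_mul]
      refine le_of_eq ?_
      have h1 := fock_hasSum (⟨shiftFun j f,
        memlp_two (hasSum_shiftFun j _ (fock_hasSum f)).summable⟩ : Fock n)
      have h2 := hasSum_shiftFun j _ (fock_hasSum f)
      exact (sq_eq_sq₀ (norm_nonneg _) (norm_nonneg _)).1 (h1.unique h2))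

/-- `F_n^∞`: the closure, in the weak operator topology, of the unital algebra generated by the
left creation operators. It carries the restriction of the weak operator topology, which is its
weak* topology. -/
def HardyAlg (n : ℕ) : Subalgebra ℂ (Fock n →WOT[ℂ] Fock n) :=
  (Algebra.adjoin ℂ
    (Set.range fun j : Fin n => ContinuousLinearMapWOT.ofCLM (creation j))).topologicalClosure

/-- The generator `S_j` of `F_n^∞`. -/
def gen {n : ℕ} (j : Fin n) : HardyAlg n :=
  ⟨ContinuousLinearMapWOT.ofCLM (creation j),
    Subalgebra.le_topologicalClosure _ (Algebra.subset_adjoin ⟨j, rfl⟩)⟩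

/-! ### Evaluation at points of the ball -/

/-- The monomial `z_{i₁} ⋯ z_{iₘ}` of a word `[i₁, …, iₘ]`. -/
def monomial {n : ℕ} (z : EuclideanSpace ℂ (Fin n)) (w : List (Fin n)) : ℂ :=
  (w.map fun i => z i).prod

theorem summable_monomial {n : ℕ} (z : Ball n) : Summable fun w => ‖monomial z.1 w‖ ^ 2 := by
  rw [← (List.equivSigmaTuple (α := Fin n)).symm.summable_iff]
  have hz : ‖z.1‖ < 1 := mem_ball_zero_iff.1 z.2
  have e : ∀ (k : ℕ) (p : Fin k → Fin n),
      ‖monomial z.1 (List.ofFn p)‖ ^ 2 = ∏ i, ‖z.1 (p i)‖ ^ 2 := by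
    intro k p
    simp [monomial, List.map_ofFn, List.prod_ofFn, Finset.prod_pow]
  refine (summable_sigma_of_nonneg (fun _ => sq_nonneg _)).2 ⟨fun k => ?_, ?_⟩
  · exact Summable.of_finite
  · have : (fun k : ℕ => ∑' p : Fin k → Fin n, ‖monomial z.1 (List.ofFn p)‖ ^ 2) =
        fun k : ℕ => (‖z.1‖ ^ 2) ^ k := by
      funext k
      rw [tsum_fintype, EuclideanSpace.norm_sq_eq, Fintype.sum_pow]
      exact Finset.sum_congr rfl fun p _ => e k p
    change Summable (fun k : ℕ => ∑' p : Fin k → Fin n, ‖monomial z.1 (List.ofFn p)‖ ^ 2)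
    rw [this]
    exact summable_geometric_of_lt_one (by positivity) (by nlinarith [norm_nonneg z.1])

/-- The vector `∑_w conj(z_w) e_w` of the Fock space. -/
def kernelVec {n : ℕ} (z : Ball n) : Fock n :=
  ⟨fun w => conj (monomial z.1 w), memlp_two (by simpa using summable_monomial z)⟩

theorem inner_kernelVec {n : ℕ} (z : Ball n) (f : Fock n) :
    ⟪kernelVec z, f⟫_ℂ = ∑' w, f w * monomial z.1 w := by
  rw [lp.inner_eq_tsum]
  simp [kernelVec]

theorem inner_kernelVec_vacuum {n : ℕ} (z : Ball n) : ⟪kernelVec z, vacuum n⟫_ℂ = 1 := by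
  rw [vacuum, lp.inner_single_right]
  simp [kernelVec, monomial]

theorem inner_kernelVec_creation {n : ℕ} (z : Ball n) (j : Fin n) (f : Fock n) :
    ⟪kernelVec z, creation j f⟫_ℂ = z.1 j * ⟪kernelVec z, f⟫_ℂ := by
  have hinj : Function.Injective (fun w : List (Fin n) => j :: w) := List.cons_injective
  rw [inner_kernelVec, inner_kernelVec, ← tsum_mul_left]
  have e : (fun w => creation j f w * monomial z.1 w) =
      Function.extend (fun w => j :: w) (fun w => z.1 j * (f w * monomial z.1 w)) 0 := by
    funext w
    change shiftFun j f w * monomial z.1 w = _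
    rw [shiftFun_eq_extend]
    by_cases h : ∃ v, j :: v = w
    · obtain ⟨v, rfl⟩ := h
      rw [hinj.extend_apply, hinj.extend_apply]
      simp only [monomial, List.map_cons, List.prod_cons]
      ring
    · rw [Function.extend_apply' _ _ _ h, Function.extend_apply' _ _ _ h]
      simp
  rw [e, tsum_extend_zero hinj]

theorem continuous_inner_kernelVec {n : ℕ} (z : Ball n) (x : Fock n) :
    Continuous fun T : Fock n →WOT[ℂ] Fock n => ⟪kernelVec z, T x⟫_ℂ :=
  ContinuousLinearMapWOT.continuous_dual_apply x (innerSL ℂ (kernelVec z))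

theorem inner_kernelVec_apply {n : ℕ} (z : Ball n) {T : Fock n →WOT[ℂ] Fock n}
    (hT : T ∈ HardyAlg n) (x : Fock n) :
    ⟪kernelVec z, T x⟫_ℂ = ⟪kernelVec z, T (vacuum n)⟫_ℂ * ⟪kernelVec z, x⟫_ℂ := by
  have hcl : IsClosed {T : Fock n →WOT[ℂ] Fock n | ∀ x, ⟪kernelVec z, T x⟫_ℂ =
      ⟪kernelVec z, T (vacuum n)⟫_ℂ * ⟪kernelVec z, x⟫_ℂ} := by
    simp only [Set.ofPred_forall]
    exact isClosed_iInter fun x => isClosed_eq (continuous_inner_kernelVec z x)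
      ((continuous_inner_kernelVec z _).mul continuous_const)
  refine closure_minimal (fun A hA => ?_) hcl hT x
  refine Algebra.adjoin_induction (p := fun A _ => ∀ x, ⟪kernelVec z, A x⟫_ℂ =
      ⟪kernelVec z, A (vacuum n)⟫_ℂ * ⟪kernelVec z, x⟫_ℂ) ?_ ?_ ?_ ?_ hA
  · rintro _ ⟨j, rfl⟩ x
    simp only [ContinuousLinearMapWOT.ofCLM_apply, inner_kernelVec_creation,
      inner_kernelVec_vacuum, mul_one]
  · intro c x
    simp only [ContinuousLinearMapWOT.algebraMapCLM_apply, inner_smul_right,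
      inner_kernelVec_vacuum, mul_one]
  · intro A B _ _ hA hB x
    simp only [ContinuousLinearMapWOT.add_apply, inner_add_right]
    rw [hA x, hB x]
    ring
  · intro A B _ _ hA hB x
    simp only [ContinuousLinearMapWOT.mul_apply]
    rw [hA (B x), hB x, hA (B (vacuum n))]
    ring

/-- The evaluation `φ ↦ φ(z)`: with `φ 1 = ∑_w a_w e_w`, it is `∑_w a_w z_w`. It is the weak*
continuous unital algebra homomorphism with `S_j ↦ z_j`. -/
def evalAt {n : ℕ} (z : Ball n) : HardyAlg n →ₐ[ℂ] ℂ where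
  toFun φ := ⟪kernelVec z, φ.1 (vacuum n)⟫_ℂ
  map_one' := inner_kernelVec_vacuum z
  map_mul' φ ψ := by
    change ⟪kernelVec z, φ.1 (ψ.1 (vacuum n))⟫_ℂ = _
    exact inner_kernelVec_apply z φ.2 _
  map_zero' := inner_zero_right _
  map_add' φ ψ := inner_add_right _ _ _
  commutes' c := by
    change ⟪kernelVec z, (algebraMap ℂ (Fock n →WOT[ℂ] Fock n) c) (vacuum n)⟫_ℂ = c
    rw [ContinuousLinearMapWOT.algebraMapCLM_apply, inner_smul_right, inner_kernelVec_vacuum,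
      mul_one]

theorem evalAt_gen {n : ℕ} (z : Ball n) (j : Fin n) : evalAt z (gen j) = z.1 j := by
  change ⟪kernelVec z, creation j (vacuum n)⟫_ℂ = _
  rw [inner_kernelVec_creation, inner_kernelVec_vacuum, mul_one]

theorem continuous_evalAt {n : ℕ} (z : Ball n) : Continuous (evalAt z) :=
  (continuous_inner_kernelVec z (vacuum n)).comp continuous_subtype_val

/-! ### The quotients `F_n^∞ / 𝒩_Δ` -/

/-- The ideal `𝒩_Δ` of the elements that vanish on `Δ`. -/
def nevanlinnaIdeal {n : ℕ} (Δ : Set (Ball n)) : Ideal (HardyAlg n) where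
  carrier := {φ | ∀ z ∈ Δ, evalAt z φ = 0}
  zero_mem' z _ := map_zero _
  add_mem' ha hb z hz := by rw [map_add, ha z hz, hb z hz, add_zero]
  smul_mem' c φ h z hz := by rw [smul_eq_mul, map_mul, h z hz, mul_zero]

instance {n : ℕ} (Δ : Set (Ball n)) : (nevanlinnaIdeal Δ).IsTwoSided where
  mul_mem_of_left b h z hz := by rw [map_mul, h z hz, zero_mul]

/-- `F_{n,Δ}^∞ = F_n^∞ / 𝒩_Δ`. -/
abbrev QuotAlg {n : ℕ} (Δ : Set (Ball n)) : Type := HardyAlg n ⧸ nevanlinnaIdeal Δ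

/-- The quotient map `F_n^∞ → F_n^∞ / 𝒩_Δ`. -/
def quotMap {n : ℕ} (Δ : Set (Ball n)) : HardyAlg n →ₐ[ℂ] QuotAlg Δ :=
  Ideal.Quotient.mkₐ ℂ (nevanlinnaIdeal Δ)

/-- The evaluation of an element of the quotient at a point of `Δ`. -/
def quotEval {n : ℕ} {Δ : Set (Ball n)} (z : Ball n) (hz : z ∈ Δ) : QuotAlg Δ →ₐ[ℂ] ℂ :=
  Ideal.Quotient.liftₐ (nevanlinnaIdeal Δ) (evalAt z) fun _ h => h z hz

theorem quotEval_quotMap {n : ℕ} {Δ : Set (Ball n)} (z : Ball n) (hz : z ∈ Δ) (φ : HardyAlg n) :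
    quotEval z hz (quotMap Δ φ) = evalAt z φ := rfl

/-- The weak* topology of `F_n^∞ / 𝒩_Δ`: the coarsest topology that makes continuous every linear
functional coming from the polar of `𝒩_Δ` in the predual of `F_n^∞`, that is, every linear
functional whose composition with the quotient map is weak* continuous on `F_n^∞`. -/
@[reducible]
def quotWeakStar {n : ℕ} (Δ : Set (Ball n)) : TopologicalSpace (QuotAlg Δ) :=
  ⨅ f : {f : QuotAlg Δ →ₗ[ℂ] ℂ // Continuous fun φ : HardyAlg n => f (quotMap Δ φ)},
    TopologicalSpace.induced f.1 inferInstance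

/-- A `k × k` matrix of operators on a Hilbert space `H`, as an operator on the Hilbert space
`H^k`. -/
def matrixOp {H : Type*} [NormedAddCommGroup H] [InnerProductSpace ℂ H] {k : ℕ}
    (A : Matrix (Fin k) (Fin k) (H →L[ℂ] H)) :
    PiLp 2 (fun _ : Fin k => H) →L[ℂ] PiLp 2 (fun _ : Fin k => H) :=
  (PiLp.continuousLinearEquiv 2 ℂ (fun _ : Fin k => H)).symm.toContinuousLinearMap.comp
    (ContinuousLinearMap.pi fun i => ∑ j, (A i j).comp (PiLp.proj 2 (fun _ : Fin k => H) j))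

/-- The norm of `M_k(F_n^∞)`, the operator norm on the `k`-fold sum of the Fock space. -/
def matrixNorm {n k : ℕ} (A : Matrix (Fin k) (Fin k) (HardyAlg n)) : ℝ :=
  ‖matrixOp fun i j => (A i j).1.toCLM‖

/-- The norm of `M_k(F_n^∞ / 𝒩_Δ) = M_k(F_n^∞) / M_k(𝒩_Δ)`, the quotient norm. -/
def quotMatrixNorm {n k : ℕ} {Δ : Set (Ball n)} (A : Matrix (Fin k) (Fin k) (QuotAlg Δ)) : ℝ :=
  sInf {r | ∃ B : Matrix (Fin k) (Fin k) (HardyAlg n), B.map (quotMap Δ) = A ∧ matrixNorm B = r}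

/-- A map between quotients that preserves the norm of `k × k` matrices for every `k`. -/
def IsCompletelyIsometric {n : ℕ} {Δ : Set (Ball n)} (Φ : QuotAlg Δ → QuotAlg Δ) : Prop :=
  ∀ (k : ℕ) (A : Matrix (Fin k) (Fin k) (QuotAlg Δ)), quotMatrixNorm (A.map Φ) = quotMatrixNorm A

/-- `Aut(F_n^∞ / 𝒩_Δ)`: the weak* continuous completely isometric algebra automorphisms. -/
def weakStarAut {n : ℕ} (Δ : Set (Ball n)) : Set (QuotAlg Δ ≃ₐ[ℂ] QuotAlg Δ) :=
  {Φ | Continuous[quotWeakStar Δ, quotWeakStar Δ] Φ ∧ IsCompletelyIsometric Φ}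

end NCHardy

end

open NCHardy

noncomputable section

namespace NCHardy

open scoped ENNReal InnerProductSpace ComplexConjugate Pointwise Topology ComplexOrder

/-! ### Row combinations of the creation operators -/

/-! Let γ ∈ SU(n,1) have matrix M with blocks A, b, c, d. It acts on F_n^∞ by the noncommutative
fractional linear map S_j ↦ (d + ∑ c_k S_k)⁻¹ (b_j + ∑ A_jk S_k). The relations M J M* = J make the
images a row isometry whose ranges are orthogonal to the unit vector (d + ∑ c_k S_k)⁻¹ vacuum, so
the words in them applied to this vector are orthonormal. The relations M* J M = J make that family
total. The resulting unitary `moebUnitary` implements φ ↦ φ ∘ γ, which is therefore weak* continuous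
and completely isometric, and descends to the quotient when γ maps Δ into itself. Elements of the
quotient are determined by their values on Δ, so identities there are checked pointwise.

Conversely, let Φ be an automorphism for the orbit Γ(0). Weak* continuous characters of F_n^∞ are
point evaluations (`exists_eq_evalAt`), and the Blaschke condition yields, as a limit of finite
products, an element of the ideal that is nonzero at a prescribed point off the orbit
(`exists_evalAt_ne_zero`). Hence Φ is composition with a map θ of the orbit. The row (S_1, …, S_n)
is contractive, and so are its images under Φ and Φ⁻¹. Tested on kernel vectors, this says that (1 -
⟨θz, θw⟩)/(1 - ⟨z, w⟩) and its entrywise inverse are both positive kernels, which forces rank one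
(`rank_one_of_posSemidef_inv`). After rescaling, (z, 1) ↦ (θz, 1) preserves the form on a spanning
family, so it extends to a matrix preserving the form, a multiple of an element of SU(n,1).

If γ maps the orbit into itself, an element of Γ corrects it to fix 0. It then preserves norms, and
each sphere contains finitely many orbit points, so injectivity gives surjectivity. For ergodicity,
an invariant element has the same value along the whole orbit, on which Γ is transitive. -/

/-- The basis vector of the Fock space at the word `w`. -/
def wordVec {n : ℕ} (w : List (Fin n)) : Fock n := lp.single 2 w 1

theorem creation_apply_nil {n : ℕ} (j : Fin n) (f : Fock n) : creation j f [] = 0 := rfl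

theorem creation_apply_cons {n : ℕ} (j i : Fin n) (f : Fock n) (w : List (Fin n)) :
    creation j f (i :: w) = if i = j then f w else 0 := rfl

theorem wordVec_apply {n : ℕ} (v w : List (Fin n)) :
    (wordVec v : Fock n) w = if w = v then 1 else 0 := by
  rw [wordVec, lp.single_apply, Pi.single_apply]

theorem creation_wordVec {n : ℕ} (j : Fin n) (w : List (Fin n)) :
    creation j (wordVec w) = wordVec (j :: w) := by
  ext v
  rcases v with _ | ⟨i, v⟩
  · simp [creation_apply_nil, wordVec_apply]
  · rw [creation_apply_cons, wordVec_apply, wordVec_apply]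
    by_cases h : i = j <;> simp [h]

theorem hasSum_wordVec {n : ℕ} (f : Fock n) : HasSum (fun w => f w • wordVec w) f := by
  have h := lp.hasSum_single (p := 2) (by norm_num) f
  convert h using 2 with w
  rw [wordVec, ← lp.single_smul, smul_eq_mul, mul_one]

theorem ext_wordVec {n : ℕ} {F : Type*} [NormedAddCommGroup F] [NormedSpace ℂ F]
    {S T : Fock n →L[ℂ] F} (h : ∀ w, S (wordVec w) = T (wordVec w)) : S = T := by
  ext f
  have h1 := (hasSum_wordVec f).mapL S
  have h2 := (hasSum_wordVec f).mapL T
  simp only [map_smul, h] at h1 h2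
  exact h1.unique h2

theorem norm_wordVec {n : ℕ} (w : List (Fin n)) : ‖(wordVec w : Fock n)‖ = 1 := by
  rw [wordVec, lp.norm_single (by norm_num), norm_one]

theorem inner_creation_creation {n : ℕ} (i j : Fin n) (f g : Fock n) :
    ⟪creation i f, creation j g⟫_ℂ = if i = j then ⟪f, g⟫_ℂ else 0 := by
  rw [lp.inner_eq_tsum, lp.inner_eq_tsum]
  split_ifs with h
  · subst h
    have hinj : Function.Injective (fun w : List (Fin n) => i :: w) := List.cons_injective
    refine Eq.trans ?_ (tsum_extend_zero hinj _)
    congr 1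
    funext w
    rcases w with _ | ⟨k, w⟩
    · rw [Function.extend_apply' _ _ _ (by simp)]
      simp [creation_apply_nil]
    · by_cases h : k = i
      · subst h
        rw [hinj.extend_apply]
        simp [creation_apply_cons]
      · rw [Function.extend_apply']
        · simp [creation_apply_cons, h]
        · rintro ⟨v, hv⟩
          exact h (by simp at hv; exact hv.1.symm)
  · convert tsum_zero with w
    rcases w with _ | ⟨k, w⟩
    · simp [creation_apply_nil]
    · by_cases h' : k = i
      · subst h'
        simp [creation_apply_cons, h]
      · simp [creation_apply_cons, h']

theorem inner_vacuum_creation {n : ℕ} (j : Fin n) (f : Fock n) :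
    ⟪vacuum n, creation j f⟫_ℂ = 0 := by
  rw [vacuum, lp.inner_single_left, creation_apply_nil, inner_zero_right]

theorem norm_vacuum {n : ℕ} : ‖vacuum n‖ = 1 := norm_wordVec []

/-- The combination `∑ cⱼ Sⱼ` of the creation operators. -/
def lin {n : ℕ} (c : Fin n → ℂ) : Fock n →L[ℂ] Fock n := ∑ j, c j • creation j

theorem lin_apply {n : ℕ} (c : Fin n → ℂ) (f : Fock n) :
    lin c f = ∑ j, c j • creation j f := by
  simp [lin]

theorem inner_sum_creation {n : ℕ} (f g : Fin n → Fock n) :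
    ⟪∑ i, creation i (f i), ∑ j, creation j (g j)⟫_ℂ = ∑ i, ⟪f i, g i⟫_ℂ := by
  simp [inner_creation_creation]

theorem norm_sum_creation {n : ℕ} (f : Fin n → Fock n) :
    ‖∑ i, creation i (f i)‖ ^ 2 = ∑ i, ‖f i‖ ^ 2 := by
  have h := inner_sum_creation f f
  simp only [inner_self_eq_norm_sq_to_K] at h
  exact_mod_cast h

/-- The creation operators are isometries with orthogonal ranges, so a combination of them is a
multiple of an isometry. -/
theorem norm_lin_apply {n : ℕ} (c : Fin n → ℂ) (f : Fock n) :
    ‖lin c f‖ ^ 2 = (∑ j, ‖c j‖ ^ 2) * ‖f‖ ^ 2 := by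
  have : lin c f = ∑ j, creation j (c j • f) := by simp [lin_apply]
  rw [this, norm_sum_creation, Finset.sum_mul]
  simp [norm_smul, mul_pow]

theorem norm_lin_le {n : ℕ} (c : Fin n → ℂ) : ‖lin c‖ ≤ √(∑ j, ‖c j‖ ^ 2) := by
  refine ContinuousLinearMap.opNorm_le_bound _ (Real.sqrt_nonneg _) fun f => ?_
  refine le_of_eq ?_
  rw [← Real.sqrt_sq (norm_nonneg (lin c f)), norm_lin_apply, Real.sqrt_mul (by positivity),
    Real.sqrt_sq (norm_nonneg f)]

theorem norm_inv_smul_lin_lt_one {n : ℕ} {c : Fin n → ℂ} {d : ℂ}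
    (h : ∑ j, ‖c j‖ ^ 2 < ‖d‖ ^ 2) : ‖-(d⁻¹ • lin c)‖ < 1 := by
  have hd : 0 < ‖d‖ := by
    by_contra h0
    have : ‖d‖ = 0 := le_antisymm (not_lt.1 h0) (norm_nonneg _)
    rw [this] at h
    have : 0 ≤ ∑ j, ‖c j‖ ^ 2 := by positivity
    simp at h
    linarith
  rw [norm_neg, norm_smul, norm_inv, inv_mul_lt_one₀ hd]
  exact (norm_lin_le c).trans_lt ((Real.sqrt_lt_sqrt (by positivity) h).trans_eq
    (Real.sqrt_sq hd.le))

/-! ### The operators of `F_n^∞` as a norm closed algebra -/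

/-- `F_n^∞` as an algebra of bounded operators. -/
def hardyOps (n : ℕ) : Subalgebra ℂ (Fock n →L[ℂ] Fock n) :=
  (HardyAlg n).comap (ContinuousLinearMapWOT.algEquiv (𝕜₁ := ℂ) (E := Fock n) ℂ).symm.toAlgHom

theorem isClosed_hardyOps (n : ℕ) : IsClosed (hardyOps n : Set (Fock n →L[ℂ] Fock n)) :=
  (Subalgebra.isClosed_topologicalClosure _).preimage ContinuousLinearMapWOT.continuous_ofCLM

theorem creation_mem_hardyOps {n : ℕ} (j : Fin n) : creation j ∈ hardyOps n := (gen j).2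

theorem lin_mem_hardyOps {n : ℕ} (c : Fin n → ℂ) : lin c ∈ hardyOps n :=
  Subalgebra.sum_mem _ fun j _ => Subalgebra.smul_mem _ (creation_mem_hardyOps j) _

/-- An affine combination `d + ∑ cⱼ Sⱼ` with `‖c‖ < |d|` is invertible in `F_n^∞`. -/
theorem exists_inverse_affine {n : ℕ} {c : Fin n → ℂ} {d : ℂ}
    (h : ∑ j, ‖c j‖ ^ 2 < ‖d‖ ^ 2) :
    ∃ R ∈ hardyOps n, R * (d • 1 + lin c) = 1 ∧ (d • 1 + lin c) * R = 1 := by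
  have ht := norm_inv_smul_lin_lt_one h
  have hd : d ≠ 0 := by
    rintro rfl
    have : 0 ≤ ∑ j, ‖c j‖ ^ 2 := by positivity
    simp at h
    linarith
  set t := -(d⁻¹ • lin c) with htdef
  have htm : t ∈ hardyOps n :=
    Subalgebra.neg_mem _ (Subalgebra.smul_mem _ (lin_mem_hardyOps c) _)
  have e : d • (1 : Fock n →L[ℂ] Fock n) + lin c = d • (1 - t) := by
    rw [htdef, sub_neg_eq_add, smul_add, smul_smul, mul_inv_cancel₀ hd, one_smul]
  have hs := (summable_geometric_of_norm_lt_one ht).hasSum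
  refine ⟨d⁻¹ • ∑' k : ℕ, t ^ k, Subalgebra.smul_mem _ ?_ _, ?_, ?_⟩
  -- The inverse is a norm convergent Neumann series, and a WOT closed algebra is norm closed.
  · exact (isClosed_hardyOps n).mem_of_tendsto hs (Filter.Eventually.of_forall fun s =>
      Subalgebra.sum_mem _ fun k _ => Subalgebra.pow_mem _ htm k)
  · rw [e, smul_mul_smul_comm, inv_mul_cancel₀ hd, one_smul, geom_series_mul_neg t ht]
  · rw [e, smul_mul_smul_comm, mul_inv_cancel₀ hd, one_smul, mul_neg_geom_series t ht]

/-! ### The blocks of an element of `SU(n,1)` -/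

/-- The upper left block of `γ`. -/
def blockA {n : ℕ} (γ : SU n) (j k : Fin n) : ℂ := toMat γ (Sum.inl j) (Sum.inl k)

/-- The upper right block of `γ`. -/
def blockB {n : ℕ} (γ : SU n) (j : Fin n) : ℂ := toMat γ (Sum.inl j) (Sum.inr ())

/-- The lower left block of `γ`. -/
def blockC {n : ℕ} (γ : SU n) (k : Fin n) : ℂ := toMat γ (Sum.inr ()) (Sum.inl k)

/-- The lower right block of `γ`. -/
def blockD {n : ℕ} (γ : SU n) : ℂ := toMat γ (Sum.inr ()) (Sum.inr ())

theorem formMatrix_mul_self (n : ℕ) : formMatrix n * formMatrix n = 1 := by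
  rw [formMatrix, Matrix.diagonal_mul_diagonal, ← Matrix.diagonal_one]
  congr 1
  funext i
  rcases i with i | i <;> simp

theorem conjTranspose_form_mul {n : ℕ} (γ : SU n) :
    (toMat γ).conjTranspose * formMatrix n * toMat γ = formMatrix n := γ.2

/-- J M* J is a left inverse of M, hence a right inverse. This turns the column relations among the
blocks into row relations. -/
theorem mul_form_conjTranspose {n : ℕ} {M : Mat n}
    (h : M.conjTranspose * formMatrix n * M = formMatrix n) :
    M * formMatrix n * M.conjTranspose = formMatrix n := by
  have h1 : (formMatrix n * M.conjTranspose * formMatrix n) * M = 1 := by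
    rw [Matrix.mul_assoc, Matrix.mul_assoc, ← Matrix.mul_assoc M.conjTranspose, h,
      formMatrix_mul_self]
  have h2 := mul_eq_one_comm.1 h1
  calc M * formMatrix n * M.conjTranspose
      = M * (formMatrix n * M.conjTranspose * formMatrix n) * formMatrix n := by
        simp only [Matrix.mul_assoc, formMatrix_mul_self, Matrix.mul_one]
    _ = formMatrix n := by rw [h2, Matrix.one_mul]

theorem conjTranspose_form_mul_apply {n : ℕ} (M : Mat n) (p q : Fin n ⊕ Unit) :
    (M.conjTranspose * formMatrix n * M) p q =
      ∑ j, conj (M (Sum.inl j) p) * M (Sum.inl j) q -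
        conj (M (Sum.inr ()) p) * M (Sum.inr ()) q := by
  rw [Matrix.mul_apply]
  simp [formMatrix, Matrix.mul_diagonal, sub_eq_add_neg]

theorem mul_form_conjTranspose_apply {n : ℕ} (M : Mat n) (p q : Fin n ⊕ Unit) :
    (M * formMatrix n * M.conjTranspose) p q =
      ∑ j, M p (Sum.inl j) * conj (M q (Sum.inl j)) -
        M p (Sum.inr ()) * conj (M q (Sum.inr ())) := by
  rw [Matrix.mul_apply]
  simp [formMatrix, Matrix.mul_diagonal, sub_eq_add_neg]

section Blocks

variable {n : ℕ} (γ : SU n)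

theorem block_col_A (k l : Fin n) :
    ∑ j, conj (blockA γ j k) * blockA γ j l - conj (blockC γ k) * blockC γ l =
      if k = l then 1 else 0 := by
  have := conjTranspose_form_mul_apply (toMat γ) (Sum.inl k) (Sum.inl l)
  rw [conjTranspose_form_mul] at this
  rw [blockC, blockC, ← Matrix.one_apply]
  refine this.symm.trans ?_
  simp [formMatrix, Matrix.diagonal_apply, Matrix.one_apply]

theorem block_col_B (k : Fin n) :
    ∑ j, conj (blockB γ j) * blockA γ j k = conj (blockD γ) * blockC γ k := by
  have := conjTranspose_form_mul_apply (toMat γ) (Sum.inr ()) (Sum.inl k)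
  rw [conjTranspose_form_mul] at this
  refine sub_eq_zero.1 (this.symm.trans ?_)
  simp [formMatrix]

theorem block_col_D :
    ∑ j, conj (blockB γ j) * blockB γ j - conj (blockD γ) * blockD γ = -1 := by
  have := conjTranspose_form_mul_apply (toMat γ) (Sum.inr ()) (Sum.inr ())
  rw [conjTranspose_form_mul] at this
  refine this.symm.trans ?_
  simp [formMatrix]

theorem block_row_A (i j : Fin n) :
    ∑ k, blockA γ j k * conj (blockA γ i k) - blockB γ j * conj (blockB γ i) =
      if i = j then 1 else 0 := by
  have := mul_form_conjTranspose_apply (toMat γ) (Sum.inl j) (Sum.inl i)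
  rw [mul_form_conjTranspose (conjTranspose_form_mul γ)] at this
  refine this.symm.trans ?_
  simp [formMatrix, Matrix.diagonal_apply, eq_comm]

theorem block_row_B (j : Fin n) :
    ∑ k, blockA γ j k * conj (blockC γ k) = blockB γ j * conj (blockD γ) := by
  have := mul_form_conjTranspose_apply (toMat γ) (Sum.inl j) (Sum.inr ())
  rw [mul_form_conjTranspose (conjTranspose_form_mul γ)] at this
  refine sub_eq_zero.1 (this.symm.trans ?_)
  simp [formMatrix]

theorem block_row_D :
    ∑ k, blockC γ k * conj (blockC γ k) - blockD γ * conj (blockD γ) = -1 := by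
  have := mul_form_conjTranspose_apply (toMat γ) (Sum.inr ()) (Sum.inr ())
  rw [mul_form_conjTranspose (conjTranspose_form_mul γ)] at this
  refine this.symm.trans ?_
  simp [formMatrix]

theorem sum_norm_blockC : ∑ k, ‖blockC γ k‖ ^ 2 = ‖blockD γ‖ ^ 2 - 1 := by
  have := block_row_D γ
  simp only [Complex.mul_conj'] at this
  have h : ((∑ k, ‖blockC γ k‖ ^ 2 : ℝ) : ℂ) = ((‖blockD γ‖ ^ 2 - 1 : ℝ) : ℂ) := by
    push_cast
    linear_combination this
  exact_mod_cast h

theorem sum_norm_blockB : ∑ k, ‖blockB γ k‖ ^ 2 = ‖blockD γ‖ ^ 2 - 1 := by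
  have := block_col_D γ
  simp only [Complex.conj_mul'] at this
  have h : ((∑ k, ‖blockB γ k‖ ^ 2 : ℝ) : ℂ) = ((‖blockD γ‖ ^ 2 - 1 : ℝ) : ℂ) := by
    push_cast
    linear_combination this
  exact_mod_cast h

/-! ### The row isometry of an element of `SU(n,1)` -/

/-- The operator `d + ∑ cₖ Sₖ`, the noncommutative denominator of `γ`. -/
def denomOp : Fock n →L[ℂ] Fock n := blockD γ • 1 + lin (blockC γ)

/-- The operators `bⱼ + ∑ Aⱼₖ Sₖ`, the noncommutative numerators of `γ`. -/
def numOp (j : Fin n) : Fock n →L[ℂ] Fock n := blockB γ j • 1 + lin (blockA γ j)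

theorem exists_denomInv : ∃ R ∈ hardyOps n, R * denomOp γ = 1 ∧ denomOp γ * R = 1 :=
  exists_inverse_affine (by rw [sum_norm_blockC]; linarith)

/-- The inverse of the noncommutative denominator. -/
def denomInv : Fock n →L[ℂ] Fock n := (exists_denomInv γ).choose

theorem denomInv_mem : denomInv γ ∈ hardyOps n := (exists_denomInv γ).choose_spec.1

theorem denomInv_mul : denomInv γ * denomOp γ = 1 := (exists_denomInv γ).choose_spec.2.1

theorem mul_denomInv : denomOp γ * denomInv γ = 1 := (exists_denomInv γ).choose_spec.2.2

/-- The image of `Sⱼ` under the noncommutative fractional linear map of `γ`. -/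
def moebOp (j : Fin n) : Fock n →L[ℂ] Fock n := denomInv γ * numOp γ j

theorem moebOp_mem (j : Fin n) : moebOp γ j ∈ hardyOps n :=
  Subalgebra.mul_mem _ (denomInv_mem γ) (Subalgebra.add_mem _
    (Subalgebra.smul_mem _ (Subalgebra.one_mem _) _) (lin_mem_hardyOps _))

theorem denomOp_mul_moebOp (j : Fin n) : denomOp γ * moebOp γ j = numOp γ j := by
  rw [moebOp, ← mul_assoc, mul_denomInv, one_mul]

/-- The image of the vacuum under the unitary of `γ`. -/
def moebVac : Fock n := denomInv γ (vacuum n)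

theorem denomOp_moebVac : denomOp γ (moebVac γ) = vacuum n := by
  rw [moebVac, ← mul_apply_eq_comp, mul_denomInv, one_apply_eq_self]

/-- The equation that defines the fractional linear image implicitly. Inner products can be computed
from it without expanding the inverse of the denominator. -/
theorem smul_moebOp_apply (j : Fin n) (f : Fock n) :
    blockD γ • moebOp γ j f = blockB γ j • f +
      ∑ k, creation k (blockA γ j k • f - blockC γ k • moebOp γ j f) := by
  have h := DFunLike.congr_fun (denomOp_mul_moebOp γ j) f
  simp only [mul_apply_eq_comp, denomOp, numOp, add_apply,
    smul_apply, one_apply_eq_self, lin_apply] at h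
  simp only [map_sub, map_smul, Finset.sum_sub_distrib]
  rw [← add_sub_assoc, ← h, add_sub_cancel_right]

theorem smul_moebVac :
    blockD γ • moebVac γ = vacuum n - ∑ k, creation k (blockC γ k • moebVac γ) := by
  have h := denomOp_moebVac γ
  simp only [denomOp, add_apply,
    smul_apply, one_apply_eq_self, lin_apply] at h
  simp only [map_smul]
  rw [← h, add_sub_cancel_right]

/-- The inner product ⟪s, t⟫ below is computed twice: from the orthogonality of the creation
operators, and from s = d x - b_i f, t = d y - b_j g. The row relations of the blocks make the mixed
terms cancel. -/
theorem inner_moebOp_moebOp (i j : Fin n) (f g : Fock n) :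
    ⟪moebOp γ i f, moebOp γ j g⟫_ℂ = if i = j then ⟪f, g⟫_ℂ else 0 := by
  set x := moebOp γ i f with hx
  set y := moebOp γ j g with hy
  have h1 := smul_moebOp_apply γ i f
  have h2 := smul_moebOp_apply γ j g
  rw [← hx] at h1
  rw [← hy] at h2
  set s := ∑ k, creation k (blockA γ i k • f - blockC γ k • x) with hs
  set t := ∑ k, creation k (blockA γ j k • g - blockC γ k • y) with ht
  have hst : ⟪s, t⟫_ℂ = (∑ k, blockA γ j k * conj (blockA γ i k)) * ⟪f, g⟫_ℂ -
      conj (∑ k, blockA γ i k * conj (blockC γ k)) * ⟪f, y⟫_ℂ -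
      (∑ k, blockA γ j k * conj (blockC γ k)) * ⟪x, g⟫_ℂ +
      (∑ k, blockC γ k * conj (blockC γ k)) * ⟪x, y⟫_ℂ := by
    rw [hs, ht, inner_sum_creation]
    simp only [inner_sub_left, inner_sub_right, inner_smul_left, inner_smul_right, map_sum,
      Finset.sum_mul, ← Finset.sum_sub_distrib, ← Finset.sum_add_distrib, map_mul,
      Complex.conj_conj]
    exact Finset.sum_congr rfl fun k _ => by ring
  rw [block_row_B, block_row_B, map_mul, Complex.conj_conj] at hst
  have e1 : s = blockD γ • x - blockB γ i • f := by rw [h1]; abel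
  have e2 : t = blockD γ • y - blockB γ j • g := by rw [h2]; abel
  rw [e1, e2] at hst
  simp only [inner_sub_left, inner_sub_right, inner_smul_left, inner_smul_right] at hst
  have hA := block_row_A γ i j
  have hD := block_row_D γ
  have key : ⟪x, y⟫_ℂ = (if i = j then 1 else 0) * ⟪f, g⟫_ℂ := by
    rw [← hA]
    linear_combination hst + ⟪x, y⟫_ℂ * hD
  rw [key]
  split_ifs <;> simp

theorem norm_moebVac : ‖moebVac γ‖ = 1 := by
  have h := smul_moebVac γ
  set x := moebVac γ
  have hst : ⟪∑ k, creation k (blockC γ k • x), ∑ k, creation k (blockC γ k • x)⟫_ℂ =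
      (∑ k, blockC γ k * conj (blockC γ k)) * ⟪x, x⟫_ℂ := by
    rw [inner_sum_creation, Finset.sum_mul]
    simp only [inner_smul_left, inner_smul_right]
    exact Finset.sum_congr rfl fun k _ => by ring
  have e : ⟪blockD γ • x, blockD γ • x⟫_ℂ = 1 +
      (∑ k, blockC γ k * conj (blockC γ k)) * ⟪x, x⟫_ℂ := by
    rw [← hst, h]
    set t := ∑ k, creation k (blockC γ k • x) with ht
    have h0 : ⟪vacuum n, t⟫_ℂ = 0 := by
      simp [ht, inner_vacuum_creation, -map_smul]
    have h0' : ⟪t, vacuum n⟫_ℂ = 0 := by rw [← inner_conj_symm, h0, map_zero]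
    have h1 : ⟪vacuum n, vacuum n⟫_ℂ = 1 := by
      rw [inner_self_eq_norm_sq_to_K, norm_vacuum]; simp
    simp only [inner_sub_left, inner_sub_right, h0, h0', h1]
    ring
  rw [inner_smul_left, inner_smul_right] at e
  have hD := block_row_D γ
  have key : ⟪x, x⟫_ℂ = 1 := by linear_combination e + ⟪x, x⟫_ℂ * hD
  rw [inner_self_eq_norm_sq_to_K] at key
  have h2 : ((‖x‖ ^ 2 : ℝ) : ℂ) = ((1 : ℝ) : ℂ) := by push_cast; exact key
  exact (pow_eq_one_iff_of_nonneg (norm_nonneg _) two_ne_zero).1 (Complex.ofReal_injective h2)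

theorem inner_moebVac_moebOp (j : Fin n) (f : Fock n) :
    ⟪moebVac γ, moebOp γ j f⟫_ℂ = 0 := by
  have h1 := smul_moebVac γ
  have h2 := smul_moebOp_apply γ j f
  set x := moebVac γ
  set y := moebOp γ j f
  set s := ∑ k, creation k (blockC γ k • x) with hs
  set t := ∑ k, creation k (blockA γ j k • f - blockC γ k • y) with ht
  have hst : ⟪s, t⟫_ℂ = (∑ k, blockA γ j k * conj (blockC γ k)) * ⟪x, f⟫_ℂ -
      (∑ k, blockC γ k * conj (blockC γ k)) * ⟪x, y⟫_ℂ := by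
    rw [hs, ht, inner_sum_creation, Finset.sum_mul, Finset.sum_mul, ← Finset.sum_sub_distrib]
    simp only [inner_sub_right, inner_smul_left, inner_smul_right]
    exact Finset.sum_congr rfl fun k _ => by ring
  have h0 : ⟪vacuum n, t⟫_ℂ = 0 := by
    simp [ht, inner_vacuum_creation, -map_smul, -map_sub]
  rw [block_row_B] at hst
  have e1 : vacuum n = blockD γ • x + s := by rw [h1]; abel
  have e2 : t = blockD γ • y - blockB γ j • f := by rw [h2]; abel
  rw [e1, inner_add_left, hst, e2] at h0
  simp only [inner_sub_right, inner_smul_left, inner_smul_right] at h0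
  have hD := block_row_D γ
  linear_combination h0 + ⟪x, y⟫_ℂ * hD

/-- Since M⁻¹ = J M* J, the inverse denominator is affine in the images of the S_j. This is the
scalar identity for the inverse fractional linear map, and it survives noncommutatively because the
denominator stands on the left. -/
theorem denomInv_eq :
    denomInv γ = conj (blockD γ) • 1 - ∑ j, conj (blockB γ j) • moebOp γ j := by
  have h : denomOp γ * (conj (blockD γ) • 1 - ∑ j, conj (blockB γ j) • moebOp γ j) = 1 := by
    have hD := block_col_D γ
    simp only [mul_sub, Finset.mul_sum, mul_smul_comm, denomOp_mul_moebOp, mul_one]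
    simp only [denomOp, numOp, smul_add, smul_smul, lin, Finset.smul_sum, Finset.sum_add_distrib]
    rw [Finset.sum_comm (γ := Fin n)]
    simp only [← Finset.sum_smul, block_col_B]
    rw [add_sub_add_right_eq_sub, ← sub_smul]
    rw [show conj (blockD γ) * blockD γ - ∑ j, conj (blockB γ j) * blockB γ j = 1 by
      linear_combination -hD, one_smul]
  calc denomInv γ = denomInv γ *
        (denomOp γ * (conj (blockD γ) • 1 - ∑ j, conj (blockB γ j) • moebOp γ j)) := by
        rw [h, mul_one]
    _ = _ := by rw [← mul_assoc, denomInv_mul, one_mul]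

/-- The inverse fractional linear map, recovering S_k from the images. It serves to show that the
isometry of γ is onto. -/
theorem creation_eq_denomOp_mul (k : Fin n) :
    creation k = denomOp γ *
      (∑ j, conj (blockA γ j k) • moebOp γ j - conj (blockC γ k) • 1) := by
  have hB : ∑ j, conj (blockA γ j k) * blockB γ j = blockD γ * conj (blockC γ k) := by
    have := congrArg conj (block_col_B γ k)
    simp only [map_sum, map_mul, Complex.conj_conj] at this
    rw [← this]
    exact Finset.sum_congr rfl fun j _ => mul_comm _ _
  simp only [mul_sub, Finset.mul_sum, mul_smul_comm, denomOp_mul_moebOp, mul_one]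
  simp only [denomOp, numOp, smul_add, smul_smul, lin, Finset.smul_sum, Finset.sum_add_distrib]
  rw [Finset.sum_comm (γ := Fin n)]
  simp only [← Finset.sum_smul]
  rw [hB, mul_comm (conj (blockC γ k)), add_sub_add_left_eq_sub, ← Finset.sum_sub_distrib]
  simp only [← sub_smul, block_col_A, ite_smul, one_smul, zero_smul, Finset.sum_ite_eq,
    Finset.mem_univ, if_true]

/-! ### The unitary of an element of `SU(n,1)` -/

/-- The image of the basis vector of a word under the unitary of `γ`. -/
def moebWord : List (Fin n) → Fock n
  | [] => moebVac γ
  | j :: w => moebOp γ j (moebWord w)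

theorem orthonormal_moebWord : Orthonormal ℂ (moebWord γ) := by
  classical
  rw [orthonormal_iff_ite]
  have hv : ⟪moebVac γ, moebVac γ⟫_ℂ = 1 := by
    rw [inner_self_eq_norm_sq_to_K, norm_moebVac]; simp
  intro v
  induction v with
  | nil =>
    rintro (_ | ⟨j, w⟩)
    · simpa [moebWord] using hv
    · simp [moebWord, inner_moebVac_moebOp]
  | cons i v ih =>
    rintro (_ | ⟨j, w⟩)
    · rw [← inner_conj_symm]
      simp [moebWord, inner_moebVac_moebOp]
    · simp only [moebWord, inner_moebOp_moebOp, ih w, List.cons.injEq]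
      split_ifs <;> simp_all

/-- The isometry of the Fock space that intertwines `Sⱼ` with the image of `Sⱼ` under `γ`. -/
def moebIsom : Fock n →ₗᵢ[ℂ] Fock n :=
  (orthonormal_moebWord γ).orthogonalFamily.linearIsometry

theorem moebIsom_wordVec (w : List (Fin n)) : moebIsom γ (wordVec w) = moebWord γ w := by
  rw [moebIsom, wordVec, OrthogonalFamily.linearIsometry_apply_single]
  simp

theorem moebIsom_creation (j : Fin n) (f : Fock n) :
    moebIsom γ (creation j f) = moebOp γ j (moebIsom γ f) := by
  have : (moebIsom γ).toContinuousLinearMap.comp (creation j) =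
      (moebOp γ j).comp (moebIsom γ).toContinuousLinearMap := by
    refine ext_wordVec fun w => ?_
    simp [creation_wordVec, moebIsom_wordVec, moebWord]
  exact DFunLike.congr_fun this f

/-- By `denomInv_eq`, the isometry intertwines conj d - ∑ conj b_j S_j with the inverse denominator.
That affine operator is invertible because ‖b‖² = |d|² - 1, so the range is invariant under the
denominator itself. -/
theorem denomOp_moebIsom_mem (f : Fock n) :
    denomOp γ (moebIsom γ f) ∈ LinearMap.range (moebIsom γ).toLinearMap := by
  obtain ⟨E, -, -, hE⟩ := exists_inverse_affine (n := n) (c := fun j => -conj (blockB γ j))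
    (d := conj (blockD γ)) (by simp [sum_norm_blockB])
  refine ⟨E f, ?_⟩
  have h1 : ∀ g : Fock n, moebIsom γ ((conj (blockD γ) • (1 : Fock n →L[ℂ] Fock n) +
      lin fun j => -conj (blockB γ j)) g) = denomInv γ (moebIsom γ g) := by
    intro g
    rw [denomInv_eq]
    simp [lin_apply, moebIsom_creation, sub_eq_add_neg]
  have h2 := h1 (E f)
  rw [← mul_apply_eq_comp, hE, one_apply_eq_self] at h2
  rw [h2, ← mul_apply_eq_comp, mul_denomInv]
  rfl

theorem creation_moebIsom_mem (k : Fin n) (f : Fock n) :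
    creation k (moebIsom γ f) ∈ LinearMap.range (moebIsom γ).toLinearMap := by
  have h : creation k (moebIsom γ f) = denomOp γ (moebIsom γ
      (∑ j, conj (blockA γ j k) • creation j f - conj (blockC γ k) • f)) := by
    conv_lhs => rw [creation_eq_denomOp_mul γ k]
    simp [moebIsom_creation]
  rw [h]
  exact denomOp_moebIsom_mem γ _

/-- The denominator sends the image of the vacuum back to the vacuum, and the range is invariant
under every creation operator. -/
theorem wordVec_mem_range_moebIsom (w : List (Fin n)) :
    wordVec w ∈ LinearMap.range (moebIsom γ).toLinearMap := by
  induction w with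
  | nil =>
    have h := denomOp_moebIsom_mem γ (wordVec [])
    rw [moebIsom_wordVec] at h
    rwa [moebWord, denomOp_moebVac] at h
  | cons j w ih =>
    obtain ⟨f, hf⟩ := ih
    rw [← creation_wordVec, ← hf]
    exact creation_moebIsom_mem γ j f

theorem moebIsom_surjective : Function.Surjective (moebIsom γ) := by
  have hcl : IsClosed (LinearMap.range (moebIsom γ).toLinearMap : Set (Fock n)) := by
    have := (moebIsom γ).isometry.isClosedEmbedding.isClosed_range
    exact this
  intro f
  exact hcl.mem_of_tendsto (hasSum_wordVec f) (Filter.Eventually.of_forall fun s =>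
    Submodule.sum_mem _ fun w _ => Submodule.smul_mem _ _ (wordVec_mem_range_moebIsom γ w))

/-- The unitary of the Fock space that implements `γ`. -/
def moebUnitary : Fock n ≃ₗᵢ[ℂ] Fock n :=
  LinearIsometryEquiv.ofSurjective (moebIsom γ) (moebIsom_surjective γ)

theorem moebUnitary_creation (j : Fin n) (f : Fock n) :
    moebUnitary γ (creation j f) = moebOp γ j (moebUnitary γ f) := moebIsom_creation γ j f

end Blocks

/-! ### Composition with an element of `SU(n,1)` on `F_n^∞` -/

/-- Conjugation by a unitary, on operators. -/
def conjOp {H : Type*} [NormedAddCommGroup H] [InnerProductSpace ℂ H] (U : H ≃ₗᵢ[ℂ] H) :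
    (H →WOT[ℂ] H) →ₐ[ℂ] (H →WOT[ℂ] H) where
  toFun T := ContinuousLinearMapWOT.ofCLM
    (U.toContinuousLinearEquiv.toContinuousLinearMap.comp
      (T.toCLM.comp U.symm.toContinuousLinearEquiv.toContinuousLinearMap))
  map_one' := by ext; simp
  map_mul' A B := by ext; simp
  map_zero' := by ext; simp
  map_add' A B := by ext; simp
  commutes' c := by ext; simp

theorem conjOp_apply {H : Type*} [NormedAddCommGroup H] [InnerProductSpace ℂ H]
    (U : H ≃ₗᵢ[ℂ] H) (T : H →WOT[ℂ] H) (x : H) : conjOp U T x = U (T (U.symm x)) := rfl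

theorem continuous_conjOp {H : Type*} [NormedAddCommGroup H] [InnerProductSpace ℂ H]
    [CompleteSpace H] (U : H ≃ₗᵢ[ℂ] H) : Continuous (conjOp U) := by
  rw [ContinuousLinearMapWOT.continuous_iff]
  intro x y
  have h : ∀ T : H →WOT[ℂ] H, ⟪y, conjOp U T x⟫_ℂ = ⟪U.symm y, T (U.symm x)⟫_ℂ := by
    intro T
    rw [conjOp_apply, ← U.inner_map_map (U.symm y), U.apply_symm_apply]
  simp only [h]
  exact ContinuousLinearMapWOT.continuous_dual_apply (U.symm x) (innerSL ℂ (U.symm y))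

theorem conjOp_moebUnitary_gen {n : ℕ} (γ : SU n) (j : Fin n) :
    conjOp (moebUnitary γ) (gen j).1 = ContinuousLinearMapWOT.ofCLM (moebOp γ j) := by
  refine ContinuousLinearMapWOT.ext fun x => ?_
  rw [conjOp_apply]
  change moebUnitary γ (creation j _) = moebOp γ j x
  rw [moebUnitary_creation, LinearIsometryEquiv.apply_symm_apply]

theorem conjOp_moebUnitary_mem {n : ℕ} (γ : SU n) {T : Fock n →WOT[ℂ] Fock n}
    (hT : T ∈ HardyAlg n) : conjOp (moebUnitary γ) T ∈ HardyAlg n := by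
  have h : HardyAlg n ≤ (HardyAlg n).comap (conjOp (moebUnitary γ)) := by
    refine Subalgebra.topologicalClosure_minimal (Algebra.adjoin_le ?_)
      ((Subalgebra.isClosed_topologicalClosure _).preimage (continuous_conjOp _))
    rintro _ ⟨j, rfl⟩
    change conjOp (moebUnitary γ) (gen j).1 ∈ HardyAlg n
    rw [conjOp_moebUnitary_gen]
    exact moebOp_mem γ j
  exact h hT

/-- The automorphism `φ ↦ φ ∘ γ` of `F_n^∞`. -/
def compHom {n : ℕ} (γ : SU n) : HardyAlg n →ₐ[ℂ] HardyAlg n :=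
  ((conjOp (moebUnitary γ)).comp (HardyAlg n).val).codRestrict (HardyAlg n)
    fun φ => conjOp_moebUnitary_mem γ φ.2

theorem continuous_compHom {n : ℕ} (γ : SU n) : Continuous (compHom γ) :=
  ((continuous_conjOp _).comp continuous_subtype_val).subtype_mk _

/-- Weak* continuous homomorphisms on `F_n^∞` are determined by the generators. -/
theorem hardyAlg_hom_ext {n : ℕ} {f g : HardyAlg n →ₐ[ℂ] ℂ} (hf : Continuous f)
    (hg : Continuous g) (h : ∀ j, f (gen j) = g (gen j)) : f = g := by
  have hle : Algebra.adjoin ℂ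
      (Set.range fun j : Fin n => ContinuousLinearMapWOT.ofCLM (creation j)) ≤
      (AlgHom.equalizer f g).map (HardyAlg n).val := by
    refine Algebra.adjoin_le ?_
    rintro _ ⟨j, rfl⟩
    exact ⟨gen j, h j, rfl⟩
  refine DFunLike.ext _ _ fun φ => ?_
  have hcl : IsClosed {φ : HardyAlg n | f φ = g φ} := isClosed_eq hf hg
  refine hcl.closure_subset (closure_subtype.2 ?_)
  exact closure_mono hle φ.2

theorem inner_kernelVec_lin {n : ℕ} (z : Ball n) (c : Fin n → ℂ) (x : Fock n) :
    ⟪kernelVec z, lin c x⟫_ℂ = (∑ j, c j * z.1 j) * ⟪kernelVec z, x⟫_ℂ := by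
  rw [lin_apply, inner_sum, Finset.sum_mul]
  refine Finset.sum_congr rfl fun j _ => ?_
  rw [inner_smul_right, inner_kernelVec_creation]
  ring

theorem denom_eq {n : ℕ} (γ : SU n) (z : EuclideanSpace ℂ (Fin n)) :
    denom γ z = ∑ k, blockC γ k * z k + blockD γ := by
  simp [denom, Matrix.mulVec, dotProduct, homog, blockC, blockD]

theorem moebius_apply {n : ℕ} (γ : SU n) (z : EuclideanSpace ℂ (Fin n)) (j : Fin n) :
    moebius γ z j = (∑ k, blockA γ j k * z k + blockB γ j) / denom γ z := by
  simp [moebius, Matrix.mulVec, dotProduct, homog, blockA, blockB]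

theorem coe_smul_ball {n : ℕ} (γ : SU n) (z : Ball n) : (γ • z).1 = moebius γ z.1 := rfl

/-- Both sides are weak* continuous characters, so the generators suffice. There the identity
denominator · image = numerator is paired with the kernel vector, on which operators of the algebra
act as scalars. -/
theorem evalAt_compHom {n : ℕ} (γ : SU n) (z : Ball n) (φ : HardyAlg n) :
    evalAt z (compHom γ φ) = evalAt (γ • z) φ := by
  have h : (evalAt z).comp (compHom γ) = evalAt (γ • z) := by
    refine hardyAlg_hom_ext ((continuous_evalAt z).comp (continuous_compHom γ))
      (continuous_evalAt _) fun j => ?_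
    rw [evalAt_gen, coe_smul_ball, moebius_apply, eq_div_iff (denom_ne_zero γ z)]
    change ⟪kernelVec z, (conjOp (moebUnitary γ) (gen j).1) (vacuum n)⟫_ℂ * _ = _
    rw [conjOp_moebUnitary_gen, ContinuousLinearMapWOT.ofCLM_apply]
    have h := congrArg (fun T : Fock n →L[ℂ] Fock n => ⟪kernelVec z, T (vacuum n)⟫_ℂ)
      (denomOp_mul_moebOp γ j)
    simp only [mul_apply_eq_comp, denomOp, numOp, add_apply, smul_apply, one_apply_eq_self,
      inner_add_right, inner_smul_right, inner_kernelVec_lin, inner_kernelVec_vacuum] at h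
    rw [denom_eq]
    linear_combination h
  exact DFunLike.congr_fun h φ

theorem matrixOp_apply {H : Type*} [NormedAddCommGroup H] [InnerProductSpace ℂ H] {k : ℕ}
    (A : Matrix (Fin k) (Fin k) (H →L[ℂ] H)) (x : PiLp 2 fun _ : Fin k => H) (i : Fin k) :
    matrixOp A x i = ∑ j, A i j (x j) := by
  simp [matrixOp]

/-- The map is conjugation by the unitary of γ repeated along the diagonal. The inequality is
enough, since γ⁻¹ supplies the reverse one on the quotient. -/
theorem matrixNorm_map_compHom_le {n k : ℕ} (γ : SU n)
    (A : Matrix (Fin k) (Fin k) (HardyAlg n)) :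
    matrixNorm (A.map (compHom γ)) ≤ matrixNorm A := by
  refine ContinuousLinearMap.opNorm_le_bound _ (norm_nonneg _) fun x => ?_
  set y : PiLp 2 fun _ : Fin k => Fock n :=
    WithLp.toLp 2 fun j => (moebUnitary γ).symm (x j) with hy
  have hxy : ‖y‖ = ‖x‖ := by
    rw [PiLp.norm_eq_of_L2, PiLp.norm_eq_of_L2]
    simp [hy]
  have hxy' : ‖matrixOp (fun i j => ((A.map (compHom γ)) i j).1.toCLM) x‖ =
      ‖matrixOp (fun i j => (A i j).1.toCLM) y‖ := by
    rw [PiLp.norm_eq_of_L2, PiLp.norm_eq_of_L2]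
    congr 1
    refine Finset.sum_congr rfl fun i _ => ?_
    have h1 := matrixOp_apply (fun i j => ((A.map (compHom γ)) i j).1.toCLM) x i
    have h2 := matrixOp_apply (fun i j => (A i j).1.toCLM) y i
    have : ∑ j, ((A.map (compHom γ)) i j).1.toCLM (x j) =
        moebUnitary γ (∑ j, (A i j).1.toCLM (y j)) := by
      rw [map_sum]
      rfl
    rw [h1, h2, this, LinearIsometryEquiv.norm_map]
  rw [hxy', ← hxy]
  exact ContinuousLinearMap.le_opNorm _ _

/-! ### The action on the quotients -/

theorem quotMap_surjective {n : ℕ} (Δ : Set (Ball n)) : Function.Surjective (quotMap Δ) :=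
  Ideal.Quotient.mkₐ_surjective _ _

/-- The elements of `F_n^∞ / 𝒩_Δ` are determined by their values on `Δ`. -/
theorem quotAlg_ext {n : ℕ} {Δ : Set (Ball n)} {a b : QuotAlg Δ}
    (h : ∀ z (hz : z ∈ Δ), quotEval z hz a = quotEval z hz b) : a = b := by
  obtain ⟨φ, rfl⟩ := quotMap_surjective Δ a
  obtain ⟨ψ, rfl⟩ := quotMap_surjective Δ b
  refine Ideal.Quotient.eq.2 fun z hz => ?_
  rw [map_sub, sub_eq_zero]
  exact h z hz

/-- Composition with `γ` on `F_n^∞ / 𝒩_Δ`, for `γ` that maps `Δ` into itself. -/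
def quotComp {n : ℕ} {Δ : Set (Ball n)} (γ : SU n) (hγ : ∀ z ∈ Δ, γ • z ∈ Δ) :
    QuotAlg Δ →ₐ[ℂ] QuotAlg Δ :=
  Ideal.Quotient.liftₐ (nevanlinnaIdeal Δ) ((quotMap Δ).comp (compHom γ)) fun φ hφ =>
    Ideal.Quotient.eq_zero_iff_mem.2 fun z hz =>
      (evalAt_compHom γ z φ).trans (hφ _ (hγ z hz))

theorem quotComp_quotMap {n : ℕ} {Δ : Set (Ball n)} (γ : SU n) (hγ : ∀ z ∈ Δ, γ • z ∈ Δ)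
    (φ : HardyAlg n) : quotComp γ hγ (quotMap Δ φ) = quotMap Δ (compHom γ φ) := rfl

theorem quotEval_quotComp {n : ℕ} {Δ : Set (Ball n)} (γ : SU n) (hγ : ∀ z ∈ Δ, γ • z ∈ Δ)
    (a : QuotAlg Δ) (z : Ball n) (hz : z ∈ Δ) :
    quotEval z hz (quotComp γ hγ a) = quotEval (γ • z) (hγ z hz) a := by
  obtain ⟨φ, rfl⟩ := quotMap_surjective Δ a
  rw [quotComp_quotMap, quotEval_quotMap, quotEval_quotMap, evalAt_compHom]

theorem quotEval_congr {n : ℕ} {Δ : Set (Ball n)} {z w : Ball n} (h : z = w) (hz : z ∈ Δ)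
    (hw : w ∈ Δ) (a : QuotAlg Δ) : quotEval z hz a = quotEval w hw a := by
  subst h
  rfl

/-! ### Quotient norms and weak* topology under composition. -/

theorem matrixNorm_nonneg {n k : ℕ} (A : Matrix (Fin k) (Fin k) (HardyAlg n)) :
    0 ≤ matrixNorm A := norm_nonneg _

theorem quotMatrixNorm_le {n k : ℕ} {Δ : Set (Ball n)}
    (B : Matrix (Fin k) (Fin k) (HardyAlg n)) :
    quotMatrixNorm (B.map (quotMap Δ)) ≤ matrixNorm B :=
  csInf_le ⟨0, by rintro _ ⟨B, -, rfl⟩; exact matrixNorm_nonneg B⟩ ⟨B, rfl, rfl⟩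

theorem quotMatrixNorm_set_nonempty {n k : ℕ} {Δ : Set (Ball n)}
    (A : Matrix (Fin k) (Fin k) (QuotAlg Δ)) :
    {r | ∃ B : Matrix (Fin k) (Fin k) (HardyAlg n),
      B.map (quotMap Δ) = A ∧ matrixNorm B = r}.Nonempty := by
  choose s hs using quotMap_surjective Δ
  exact ⟨_, A.map s, by ext i j; simp [hs], rfl⟩

theorem quotMatrixNorm_map_quotComp_le {n k : ℕ} {Δ : Set (Ball n)} (γ : SU n)
    (hγ : ∀ z ∈ Δ, γ • z ∈ Δ) (A : Matrix (Fin k) (Fin k) (QuotAlg Δ)) :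
    quotMatrixNorm (A.map (quotComp γ hγ)) ≤ quotMatrixNorm A := by
  refine le_csInf (quotMatrixNorm_set_nonempty A) ?_
  rintro _ ⟨B, rfl, rfl⟩
  refine le_trans ?_ (matrixNorm_map_compHom_le γ B)
  exact quotMatrixNorm_le (B.map (compHom γ))

theorem continuous_quotMap {n : ℕ} (Δ : Set (Ball n)) :
    Continuous[_, quotWeakStar Δ] (quotMap Δ) :=
  continuous_iInf_rng.2 fun f => continuous_induced_rng.2 f.2

theorem continuous_quotEval {n : ℕ} {Δ : Set (Ball n)} (z : Ball n) (hz : z ∈ Δ) :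
    Continuous[quotWeakStar Δ, _] (quotEval z hz) :=
  continuous_iInf_dom (i := ⟨(quotEval z hz).toLinearMap, continuous_evalAt z⟩)
    continuous_induced_dom

theorem continuous_quotComp {n : ℕ} {Δ : Set (Ball n)} (γ : SU n)
    (hγ : ∀ z ∈ Δ, γ • z ∈ Δ) :
    Continuous[quotWeakStar Δ, quotWeakStar Δ] (quotComp γ hγ) := by
  refine continuous_iInf_rng.2 fun f => continuous_induced_rng.2 ?_
  refine continuous_iInf_dom (i := ⟨f.1.comp (quotComp γ hγ).toLinearMap,
    f.2.comp (continuous_compHom γ)⟩) continuous_induced_dom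

/-! ### The automorphisms given by the stabilizer of Δ. -/

section Stabilizer

variable {n : ℕ} {Δ : Set (Ball n)}

theorem smul_mem_of_mem_stabilizer (γ : MulAction.stabilizer (SU n) Δ) :
    ∀ z ∈ Δ, γ.1 • z ∈ Δ := by
  intro z hz
  have h : γ.1 • Δ = Δ := γ.2
  exact h.subset (Set.smul_mem_smul_set hz)

/-- The automorphism `a ↦ a ∘ γ⁻¹` of `F_n^∞ / 𝒩_Δ`, for `γ` in the stabilizer of `Δ`. -/
def quotAutEquiv (γ : MulAction.stabilizer (SU n) Δ) : QuotAlg Δ ≃ₐ[ℂ] QuotAlg Δ :=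
  AlgEquiv.ofAlgHom
    -- Composition is contravariant; the inverse makes the action a homomorphism.
    (quotComp (γ⁻¹ : MulAction.stabilizer (SU n) Δ).1 (smul_mem_of_mem_stabilizer γ⁻¹))
    (quotComp γ.1 (smul_mem_of_mem_stabilizer γ))
    (AlgHom.ext fun a => quotAlg_ext fun z hz => by
      simp only [AlgHom.comp_apply, quotEval_quotComp, AlgHom.id_apply]
      exact quotEval_congr (by simp) _ _ _)
    (AlgHom.ext fun a => quotAlg_ext fun z hz => by
      simp only [AlgHom.comp_apply, quotEval_quotComp, AlgHom.id_apply]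
      exact quotEval_congr (by simp) _ _ _)

theorem quotEval_quotAutEquiv (γ : MulAction.stabilizer (SU n) Δ) (a : QuotAlg Δ) (z : Ball n)
    (hz : z ∈ Δ) : quotEval z hz (quotAutEquiv γ a) =
      quotEval ((γ⁻¹ : MulAction.stabilizer (SU n) Δ).1 • z)
        (smul_mem_of_mem_stabilizer γ⁻¹ z hz) a :=
  quotEval_quotComp _ _ _ _ _

/-- The action of the stabilizer of `Δ` on `F_n^∞ / 𝒩_Δ`. -/
def quotAut (Δ : Set (Ball n)) :
    MulAction.stabilizer (SU n) Δ →* (QuotAlg Δ ≃ₐ[ℂ] QuotAlg Δ) where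
  toFun := quotAutEquiv
  map_one' := AlgEquiv.ext fun a => quotAlg_ext fun z hz => by
    rw [quotEval_quotAutEquiv]
    exact quotEval_congr (by simp) _ _ _
  map_mul' γ δ := AlgEquiv.ext fun a => quotAlg_ext fun z hz => by
    rw [AlgEquiv.mul_apply, quotEval_quotAutEquiv, quotEval_quotAutEquiv, quotEval_quotAutEquiv]
    exact quotEval_congr (by simp [mul_smul]) _ _ _

theorem quotEval_quotAut (γ : MulAction.stabilizer (SU n) Δ) (a : QuotAlg Δ) (z : Ball n)
    (hz : z ∈ Δ) (hz' : γ.1 • z ∈ Δ) :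
    quotEval (γ.1 • z) hz' (quotAut Δ γ a) = quotEval z hz a :=
  (quotEval_quotAutEquiv γ a _ hz').trans (quotEval_congr (by simp) _ _ _)

theorem quotAut_mem_weakStarAut (γ : MulAction.stabilizer (SU n) Δ) :
    quotAut Δ γ ∈ weakStarAut Δ := by
  refine ⟨continuous_quotComp _ (smul_mem_of_mem_stabilizer γ⁻¹), fun k A => le_antisymm ?_ ?_⟩
  · exact quotMatrixNorm_map_quotComp_le _ (smul_mem_of_mem_stabilizer γ⁻¹) A
  · have h := quotMatrixNorm_map_quotComp_le γ.1 (smul_mem_of_mem_stabilizer γ)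
      (A.map (quotAut Δ γ))
    refine le_trans (le_of_eq ?_) h
    congr 1
    ext i j
    exact ((quotAut Δ γ).symm_apply_apply _).symm

end Stabilizer

/-! ### Estimates for the fractional linear action -/

theorem norm_ball_lt_one {n : ℕ} (z : Ball n) : ‖z.1‖ < 1 := mem_ball_zero_iff.1 z.2

theorem one_sub_norm_sq_smul {n : ℕ} (γ : SU n) (z : Ball n) :
    1 - ‖(γ • z).1‖ ^ 2 = (1 - ‖z.1‖ ^ 2) / ‖denom γ z.1‖ ^ 2 := by
  have hd : 0 < ‖denom γ z.1‖ ^ 2 := pow_pos (norm_pos_iff.2 (denom_ne_zero γ z)) 2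
  have h := form_preserved γ (homog z.1)
  rw [homog_moebius] at h
  simp only [homog, Pi.smul_apply, Sum.elim_inl, Sum.elim_inr, norm_smul, norm_one, mul_one,
    mul_pow, ← Finset.mul_sum, ← EuclideanSpace.norm_sq_eq] at h
  rw [coe_smul_ball, eq_div_iff hd.ne']
  linarith

theorem denom_origin {n : ℕ} (γ : SU n) : denom γ (Ball.origin n).1 = blockD γ := by
  simp [denom_eq, Ball.origin]

theorem one_le_norm_blockD {n : ℕ} (γ : SU n) : 1 ≤ ‖blockD γ‖ := by
  have h := sum_norm_blockC γ
  have h0 : 0 ≤ ∑ k, ‖blockC γ k‖ ^ 2 := by positivity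
  have : 1 ≤ ‖blockD γ‖ ^ 2 := by linarith
  exact (one_le_sq_iff₀ (norm_nonneg _)).1 this

/-- Cauchy–Schwarz, with ‖c‖² = |d|² - 1 ≤ |d|². -/
theorem norm_blockD_mul_le {n : ℕ} (γ : SU n) (z : Ball n) :
    ‖blockD γ‖ * (1 - ‖z.1‖) ≤ ‖denom γ z.1‖ := by
  have h1 : ‖∑ k, blockC γ k * z.1 k‖ ≤ ‖blockD γ‖ * ‖z.1‖ := by
    refine (norm_sum_le _ _).trans ?_
    simp only [norm_mul]
    refine (Real.sum_mul_le_sqrt_mul_sqrt _ _ _).trans ?_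
    rw [← EuclideanSpace.norm_eq]
    refine mul_le_mul_of_nonneg_right ?_ (norm_nonneg _)
    rw [sum_norm_blockC]
    exact Real.sqrt_le_iff.2 ⟨norm_nonneg _, by linarith⟩
  rw [denom_eq]
  have h2 := norm_sub_norm_le (blockD γ) (-∑ k, blockC γ k * z.1 k)
  rw [norm_neg, sub_neg_eq_add, add_comm (blockD γ)] at h2
  linarith

/-- The constant does not depend on γ, so the Blaschke condition at 0 implies the one at every z.
The proof compares 1 - ‖γ(0)‖² = 1/|d|² with the same expression at z. -/
theorem one_sub_norm_smul_le {n : ℕ} (γ : SU n) (z : Ball n) :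
    1 - ‖(γ • z).1‖ ≤ 2 / (1 - ‖z.1‖) ^ 2 * (1 - ‖(γ • Ball.origin n).1‖) := by
  have hz := norm_ball_lt_one z
  have hz' : 0 < 1 - ‖z.1‖ := by linarith
  have hD : 0 < ‖blockD γ‖ := zero_lt_one.trans_le (one_le_norm_blockD γ)
  have h1 := one_sub_norm_sq_smul γ z
  have h2 := one_sub_norm_sq_smul γ (Ball.origin n)
  rw [denom_origin] at h2
  have h0 : ‖(Ball.origin n).1‖ = 0 := by simp [Ball.origin]
  rw [h0] at h2
  have ha := norm_ball_lt_one (γ • z)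
  have hb := norm_ball_lt_one (γ • Ball.origin n)
  set a := ‖(γ • z).1‖
  set b := ‖(γ • Ball.origin n).1‖
  have ha0 : 0 ≤ a := norm_nonneg _
  have hb0 : 0 ≤ b := norm_nonneg _
  calc 1 - a ≤ 1 - a ^ 2 := by nlinarith
    _ = (1 - ‖z.1‖ ^ 2) / ‖denom γ z.1‖ ^ 2 := h1
    _ ≤ 1 / (‖blockD γ‖ * (1 - ‖z.1‖)) ^ 2 := by
        refine div_le_div₀ zero_le_one (by nlinarith [norm_nonneg z.1]) (by positivity) ?_
        exact pow_le_pow_left₀ (by positivity) (norm_blockD_mul_le γ z) 2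
    _ = 1 / (1 - ‖z.1‖) ^ 2 * (1 - b ^ 2) := by
        rw [h2]
        field_simp
        norm_num
    _ ≤ 1 / (1 - ‖z.1‖) ^ 2 * (2 * (1 - b)) := by
        refine mul_le_mul_of_nonneg_left ?_ (by positivity)
        nlinarith
    _ = _ := by ring

/-! ### The set of zeros of `𝒩_Δ` for an orbit `Δ` -/

theorem norm_compHom_le {n : ℕ} (γ : SU n) (φ : HardyAlg n) :
    ‖(compHom γ φ).1.toCLM‖ ≤ ‖φ.1.toCLM‖ := by
  refine ContinuousLinearMap.opNorm_le_bound _ (norm_nonneg _) fun x => ?_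
  change ‖moebUnitary γ (φ.1.toCLM ((moebUnitary γ).symm x))‖ ≤ _
  rw [LinearIsometryEquiv.norm_map, ← (moebUnitary γ).symm.norm_map x]
  exact ContinuousLinearMap.le_opNorm _ _

/-- The combination `∑ cⱼ Sⱼ` of the generators of `F_n^∞`. -/
def linElt {n : ℕ} (c : Fin n → ℂ) : HardyAlg n := ∑ j, c j • gen j

theorem evalAt_linElt {n : ℕ} (z : Ball n) (c : Fin n → ℂ) :
    evalAt z (linElt c) = ∑ j, c j * z.1 j := by
  simp [linElt, evalAt_gen]

theorem linElt_toCLM {n : ℕ} (c : Fin n → ℂ) : (linElt c).1.toCLM = lin c := by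
  have h : (linElt c).1 = ∑ j, c j • (gen j).1 := by
    simp [linElt]
  have h2 : ∀ T : Fock n →WOT[ℂ] Fock n,
      T.toCLM = ContinuousLinearMapWOT.linearEquiv (σ := RingHom.id ℂ) ℂ T := fun _ => rfl
  rw [h, h2, map_sum, lin]
  refine Finset.sum_congr rfl fun j _ => ?_
  rw [map_smul]
  rfl

theorem conj_mul_div_norm {n : ℕ} (w : EuclideanSpace ℂ (Fin n)) :
    ∑ j, conj (w j) / ‖w‖ * w j = ‖w‖ := by
  have h : ∑ j, conj (w j) / ‖w‖ * w j = (∑ j, ‖w j‖ ^ 2 : ℝ) / ‖w‖ := by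
    push_cast
    rw [Finset.sum_div]
    refine Finset.sum_congr rfl fun j _ => ?_
    rw [← Complex.conj_mul']
    ring
  rw [h, ← EuclideanSpace.norm_sq_eq]
  -- For w = 0 both sides vanish, since division by zero gives zero.
  rcases eq_or_ne w 0 with rfl | hw
  · simp
  · have : (‖w‖ : ℂ) ≠ 0 := by exact_mod_cast norm_ne_zero_iff.2 hw
    push_cast
    field_simp

theorem sum_norm_conj_div_norm_le {n : ℕ} (w : EuclideanSpace ℂ (Fin n)) :
    ∑ j, ‖conj (w j) / (‖w‖ : ℂ)‖ ^ 2 ≤ 1 := by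
  simp only [norm_div, div_pow, RCLike.norm_conj, Complex.norm_real, norm_norm]
  rw [← Finset.sum_div, ← EuclideanSpace.norm_sq_eq]
  exact div_self_le_one _

/-- A contraction of `F_n^∞` with a zero at `γ(0)` and the largest possible value at `z`. -/
theorem exists_blaschke_factor {n : ℕ} (γ : SU n) (z : Ball n) :
    ∃ φ : HardyAlg n, ‖φ.1.toCLM‖ ≤ 1 ∧ evalAt (γ • Ball.origin n) φ = 0 ∧
      ‖evalAt z φ‖ = ‖(γ⁻¹ • z).1‖ := by
  set w := (γ⁻¹ • z).1 with hw
  -- Move γ(0) to the origin and take the linear functional that norms the image w of z.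
  refine ⟨compHom γ⁻¹ (linElt fun j => conj (w j) / ‖w‖), ?_, ?_, ?_⟩
  · refine (norm_compHom_le _ _).trans ?_
    rw [linElt_toCLM]
    exact (norm_lin_le _).trans (Real.sqrt_le_one.2 (sum_norm_conj_div_norm_le w))
  · rw [evalAt_compHom, inv_smul_smul, evalAt_linElt]
    simp [Ball.origin]
  · rw [evalAt_compHom, evalAt_linElt, ← hw, conj_mul_div_norm]
    simp

/-- Bounded families of operators converge along ultrafilters in the weak operator topology. -/
theorem exists_wot_limit {ι H : Type*} [NormedAddCommGroup H] [InnerProductSpace ℂ H]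
    [CompleteSpace H] (l : Ultrafilter ι) (T : ι → H →L[ℂ] H) {C : ℝ} (hT : ∀ i, ‖T i‖ ≤ C) :
    ∃ T₀ : H →WOT[ℂ] H,
      Filter.Tendsto (fun i => ContinuousLinearMapWOT.ofCLM (T i)) l (𝓝 T₀) := by
  have hb : ∀ x y i, ‖⟪T i x, y⟫_ℂ‖ ≤ C * ‖x‖ * ‖y‖ := fun x y i =>
    (norm_inner_le_norm _ _).trans (mul_le_mul_of_nonneg_right
      ((T i).le_of_opNorm_le (hT i) x) (norm_nonneg _))
  -- Each matrix coefficient stays in a compact disc, so it converges along the ultrafilter. The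
  -- limits form a bounded sesquilinear form, which the Riesz representation turns into an operator.
  have hlim : ∀ x y, ∃ c : ℂ, ‖c‖ ≤ C * ‖x‖ * ‖y‖ ∧
      Filter.Tendsto (fun i => ⟪T i x, y⟫_ℂ) l (𝓝 c) := by
    intro x y
    obtain ⟨c, hc, hlc⟩ := (isCompact_closedBall (0 : ℂ) (C * ‖x‖ * ‖y‖)).ultrafilter_le_nhds'
      (l.map fun i => ⟪T i x, y⟫_ℂ)
      (Filter.mem_map.2 (Filter.Eventually.of_forall fun i => mem_closedBall_zero_iff.2 (hb x y i)))
    exact ⟨c, mem_closedBall_zero_iff.1 hc, hlc⟩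
  choose B hB hBl using hlim
  let S : H →L⋆[ℂ] H →L[ℂ] ℂ := LinearMap.mkContinuous₂
    (LinearMap.mk₂'ₛₗ (starRingEnd ℂ) (RingHom.id ℂ) B
      (fun x x' y => tendsto_nhds_unique (hBl _ _) (by
        simpa only [map_add, inner_add_left] using (hBl x y).add (hBl x' y)))
      (fun c x y => tendsto_nhds_unique (hBl _ _) (by
        simpa only [map_smul, inner_smul_left, smul_eq_mul] using (hBl x y).const_mul (conj c)))
      (fun x y y' => tendsto_nhds_unique (hBl _ _) (by
        simpa only [inner_add_right] using (hBl x y).add (hBl x y')))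
      (fun c x y => tendsto_nhds_unique (hBl _ _) (by
        simpa only [inner_smul_right, smul_eq_mul, RingHom.id_apply] using
          (hBl x y).const_mul c)))
    C hB
  refine ⟨ContinuousLinearMapWOT.ofCLM (InnerProductSpace.continuousLinearMapOfBilin S),
    ContinuousLinearMapWOT.tendsto_iff_forall_inner_apply_tendsto.2 fun x y => ?_⟩
  simp only [ContinuousLinearMapWOT.ofCLM_apply]
  simp only [← inner_conj_symm y]
  rw [InnerProductSpace.continuousLinearMapOfBilin_apply]
  exact (Complex.continuous_conj.tendsto _).comp (hBl x y)

theorem norm_list_prod_le_one {n : ℕ} (L : List (HardyAlg n))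
    (h : ∀ φ ∈ L, ‖φ.1.toCLM‖ ≤ 1) : ‖L.prod.1.toCLM‖ ≤ 1 := by
  refine List.prod_induction (fun φ : HardyAlg n => ‖φ.1.toCLM‖ ≤ 1) ?_ ?_ h
  · intro φ ψ hφ hψ
    exact (norm_mul_le φ.1.toCLM ψ.1.toCLM).trans (mul_le_one₀ hφ (norm_nonneg _) hψ)
  · exact ContinuousLinearMap.norm_id_le

/-- An orbit that satisfies the Blaschke condition is the set of zeros of its ideal. -/
theorem exists_evalAt_ne_zero {n : ℕ} {Γ : Subgroup (SU n)}
    (hΓ : Summable fun γ : Γ => 1 - ‖(γ.1 • Ball.origin n).1‖) {z : Ball n}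
    (hz : z ∉ orbit Γ) : ∃ φ ∈ nevanlinnaIdeal (orbit Γ), evalAt z φ ≠ 0 := by
  classical
  choose f hf1 hf0 hfz using fun γ : Γ => exists_blaschke_factor γ.1 z
  -- Finite Blaschke products. The factors need not commute, but only scalar values are used, so the
  -- order chosen by `toList` is harmless.
  set P : Finset Γ → HardyAlg n := fun F => (F.toList.map f).prod with hP
  have hev : ∀ w F, evalAt w (P F) = ∏ γ ∈ F, evalAt w (f γ) := by
    intro w F
    rw [hP, map_list_prod, List.map_map, ← Finset.prod_map_toList]
    rfl
  set l : Ultrafilter (Finset Γ) := Ultrafilter.of Filter.atTop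
  have hl : (l : Filter (Finset Γ)) ≤ Filter.atTop := Ultrafilter.of_le _
  obtain ⟨T₀, hT₀⟩ := exists_wot_limit l (fun F => (P F).1.toCLM) (C := 1) fun F =>
    norm_list_prod_le_one _ (by
      intro φ hφ
      obtain ⟨γ, -, rfl⟩ := List.mem_map.1 hφ
      exact hf1 γ)
  have hmem : T₀ ∈ HardyAlg n :=
    (Subalgebra.isClosed_topologicalClosure _).mem_of_tendsto hT₀
      (Filter.Eventually.of_forall fun F => (P F).2)
  have hT : Filter.Tendsto P l (𝓝 ⟨T₀, hmem⟩) := tendsto_subtype_rng.2 hT₀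
  have hTev : ∀ w, Filter.Tendsto (fun F => ∏ γ ∈ F, evalAt w (f γ)) l
      (𝓝 (evalAt w ⟨T₀, hmem⟩)) := by
    intro w
    simp only [← hev]
    exact ((continuous_evalAt w).tendsto _).comp hT
  refine ⟨⟨T₀, hmem⟩, ?_, ?_⟩
  · rintro _ ⟨γ, rfl⟩
    refine tendsto_nhds_unique (hTev _) (tendsto_const_nhds.congr' ?_)
    -- Once F contains γ, the product has a factor vanishing at γ(0).
    filter_upwards [hl (Filter.eventually_ge_atTop {γ})] with F hF
    exact (Finset.prod_eq_zero (Finset.singleton_subset_iff.1 hF) (hf0 γ)).symm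
  · have hs : Summable fun γ : Γ => 1 - ‖(γ.1⁻¹ • z).1‖ := by
      have h1 : Summable fun γ : Γ => 1 - ‖(γ.1⁻¹ • Ball.origin n).1‖ :=
        (Equiv.inv Γ).summable_iff.2 hΓ
      refine Summable.of_nonneg_of_le (fun γ => ?_) (fun γ => one_sub_norm_smul_le γ.1⁻¹ z)
        (h1.mul_left _)
      linarith [norm_ball_lt_one (γ.1⁻¹ • z)]
    -- A zero factor would put z in the orbit. With all factors nonzero and the deviations from 1
    -- summable, the infinite product is nonzero.
    have hne : ∀ γ : Γ, ‖(γ.1⁻¹ • z).1‖ ≠ 0 := by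
      intro γ h0
      have h1 : γ.1⁻¹ • z = Ball.origin n := Subtype.ext (norm_eq_zero.1 h0)
      exact hz ⟨γ, by rw [← h1]; exact smul_inv_smul γ.1 z⟩
    have hsum : Summable fun γ : Γ => ‖-(1 - ‖(γ.1⁻¹ • z).1‖)‖ := by
      simpa only [norm_neg] using hs.norm
    have hprod := (multipliable_one_add_of_summable hsum).hasProd
    have hprod0 := tprod_one_add_ne_zero_of_summable (by simpa using hne) hsum
    have h2 : Filter.Tendsto (fun F : Finset Γ => ∏ γ ∈ F, ‖evalAt z (f γ)‖) l
        (𝓝 (∏' γ : Γ, (1 + -(1 - ‖(γ.1⁻¹ • z).1‖)))) := by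
      refine Filter.Tendsto.congr (fun F => ?_) (hprod.mono_left hl)
      refine Finset.prod_congr rfl fun γ _ => ?_
      rw [hfz]
      ring
    have h3 := (hTev z).norm
    simp only [norm_prod] at h3
    rw [← norm_ne_zero_iff, tendsto_nhds_unique h3 h2]
    exact hprod0

/-! ### Elements of `SU(n,1)` that map an orbit into itself -/

theorem origin_mem_orbit {n : ℕ} (Γ : Subgroup (SU n)) : Ball.origin n ∈ orbit Γ :=
  MulAction.mem_orbit_self _

theorem smul_mem_orbit_of_mem {n : ℕ} {Γ : Subgroup (SU n)} {γ : SU n} (hγ : γ ∈ Γ) {z : Ball n}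
    (hz : z ∈ orbit Γ) : γ • z ∈ orbit Γ :=
  smul_mem_orbit ⟨γ, le_orbitStabilizer Γ hγ⟩ hz

/-- Fixing the origin forces |d| = 1, hence c = 0, so the denominator has modulus one everywhere. -/
theorem norm_smul_of_smul_origin {n : ℕ} {γ : SU n} (h : γ • Ball.origin n = Ball.origin n)
    (z : Ball n) : ‖(γ • z).1‖ = ‖z.1‖ := by
  have h2 := one_sub_norm_sq_smul γ (Ball.origin n)
  rw [h, denom_origin] at h2
  have h0 : ‖(Ball.origin n).1‖ = 0 := by simp [Ball.origin]
  have hD : 0 < ‖blockD γ‖ := zero_lt_one.trans_le (one_le_norm_blockD γ)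
  rw [h0, eq_div_iff (by positivity)] at h2
  have hC : ∑ k, ‖blockC γ k‖ ^ 2 = 0 := by rw [sum_norm_blockC]; linarith
  have hC' : ∀ k, blockC γ k = 0 := fun k => by
    have := (Finset.sum_eq_zero_iff_of_nonneg fun i _ => sq_nonneg ‖blockC γ i‖).1 hC k
      (Finset.mem_univ k)
    simpa using this
  have h3 := one_sub_norm_sq_smul γ z
  have h4 : ‖denom γ z.1‖ ^ 2 = 1 := by
    rw [denom_eq]
    simp only [hC', zero_mul, Finset.sum_const_zero, zero_add]
    linarith
  rw [h4, div_one] at h3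
  have h5 : ‖(γ • z).1‖ ^ 2 = ‖z.1‖ ^ 2 := by linarith
  exact (sq_eq_sq₀ (norm_nonneg _) (norm_nonneg _)).1 h5

/-- The terms of a summable family exceed any positive bound only finitely often. -/
theorem finite_orbit_norm_eq {n : ℕ} {Γ : Subgroup (SU n)}
    (hΓ : Summable fun γ : Γ => 1 - ‖(γ.1 • Ball.origin n).1‖) {r : ℝ} (hr : r < 1) :
    {z ∈ orbit Γ | ‖z.1‖ = r}.Finite := by
  have h1 : {γ : Γ | ¬ 1 - ‖(γ.1 • Ball.origin n).1‖ < 1 - r}.Finite :=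
    hΓ.tendsto_cofinite_zero.eventually (gt_mem_nhds (sub_pos.2 hr))
  refine (h1.image fun γ : Γ => γ.1 • Ball.origin n).subset ?_
  rintro z ⟨⟨γ, rfl⟩, hz⟩
  refine ⟨γ, ?_, rfl⟩
  have : ‖(γ.1 • Ball.origin n).1‖ = r := hz
  simp [this]

/-- An element of `SU(n,1)` that maps an orbit with the Blaschke condition into itself maps it
onto itself. -/
theorem mem_orbitStabilizer_iff {n : ℕ} {Γ : Subgroup (SU n)}
    (hΓ : Summable fun γ : Γ => 1 - ‖(γ.1 • Ball.origin n).1‖) (γ : SU n) :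
    γ ∈ orbitStabilizer Γ ↔ ∀ z ∈ orbit Γ, γ • z ∈ orbit Γ := by
  refine ⟨fun h z hz => smul_mem_orbit ⟨γ, h⟩ hz, fun h => ?_⟩
  refine MulAction.mem_stabilizer_iff.2 (Set.Subset.antisymm ?_ ?_)
  · rintro _ ⟨z, hz, rfl⟩
    exact h z hz
  -- With g ∈ Γ such that g(0) = γ(0), the element g⁻¹γ fixes 0 and maps each finite set of orbit
  -- points of a given norm injectively into itself, hence onto itself.
  obtain ⟨g, hg⟩ := h _ (origin_mem_orbit Γ)
  have hg' : g.1 • Ball.origin n = γ • Ball.origin n := hg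
  have h0 : (g.1⁻¹ * γ) • Ball.origin n = Ball.origin n := by
    rw [mul_smul, ← hg', inv_smul_smul]
  intro w hw
  set r := ‖(g.1⁻¹ • w).1‖
  have hfin := finite_orbit_norm_eq hΓ (norm_ball_lt_one (g.1⁻¹ • w))
  have hmaps : Set.MapsTo (fun z => (g.1⁻¹ * γ) • z) {z ∈ orbit Γ | ‖z.1‖ = r}
      {z ∈ orbit Γ | ‖z.1‖ = r} := by
    rintro z ⟨hz, hzr⟩
    refine ⟨?_, (norm_smul_of_smul_origin h0 z).trans hzr⟩
    change (g.1⁻¹ * γ) • z ∈ orbit Γ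
    rw [mul_smul]
    exact smul_mem_orbit_of_mem (Γ.inv_mem g.2) (h z hz)
  have hsurj := (hfin.eq_of_subset_of_encard_le' hmaps.image_subset
    (MulAction.injective (g.1⁻¹ * γ)).injOn.encard_image.ge).ge
  obtain ⟨z, ⟨hz, -⟩, hzw⟩ := hsurj (show g.1⁻¹ • w ∈ {z ∈ orbit Γ | ‖z.1‖ = r} from
    ⟨smul_mem_orbit_of_mem (Γ.inv_mem g.2) hw, rfl⟩)
  refine ⟨z, hz, ?_⟩
  have hzw' : (g.1⁻¹ * γ) • z = g.1⁻¹ • w := hzw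
  rw [mul_smul] at hzw'
  exact MulAction.injective _ hzw'

/-! ### Weak* continuous characters of `F_n^∞` -/

theorem lin_apply_nil {n : ℕ} (a : Fin n → ℂ) (f : Fock n) : lin a f [] = 0 := by
  have h : ∀ g : Fock n, g [] = ⟪vacuum n, g⟫_ℂ := fun g => by
    rw [vacuum, lp.inner_single_left]
    simp
  rw [h, lin_apply, inner_sum]
  simp [inner_vacuum_creation, -map_smul, inner_smul_right]

theorem lin_apply_cons {n : ℕ} (a : Fin n → ℂ) (f : Fock n) (i : Fin n) (w : List (Fin n)) :
    lin a f (i :: w) = a i * f w := by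
  have h : ∀ (v : List (Fin n)) (g : Fock n), g v = ⟪wordVec v, g⟫_ℂ := fun v g => by
    rw [wordVec, lp.inner_single_left]
    simp
  rw [h, lin_apply, inner_sum, h w, ← creation_wordVec]
  simp [inner_smul_right, inner_creation_creation]

/-- Each factor lengthens words by one letter. -/
theorem lin_pow_apply_eq_zero {n : ℕ} (a : Fin n → ℂ) (f : Fock n) (w : List (Fin n)) (m : ℕ)
    (h : w.length < m) : (lin a ^ m) f w = 0 := by
  induction m generalizing w with
  | zero => simp at h
  | succ m ih =>
    rw [pow_succ', mul_apply_eq_comp]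
    rcases w with _ | ⟨i, w⟩
    · exact lin_apply_nil _ _
    · rw [lin_apply_cons, ih w (by simpa using h), mul_zero]

theorem norm_lin_pow_apply {n : ℕ} {a : Fin n → ℂ} (ha : ∑ j, ‖a j‖ ^ 2 = 1) (f : Fock n)
    (m : ℕ) : ‖(lin a ^ m) f‖ = ‖f‖ := by
  induction m with
  | zero => simp
  | succ m ih =>
    rw [pow_succ', mul_apply_eq_comp, ← ih]
    have h := norm_lin_apply a ((lin a ^ m) f)
    rw [ha, one_mul] at h
    exact (sq_eq_sq₀ (norm_nonneg _) (norm_nonneg _)).1 h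

/-- The powers are isometric, but they push every vector into ever longer words, so they become
orthogonal to any finite combination of word vectors. Such combinations approximate y. -/
theorem tendsto_inner_lin_pow {n : ℕ} {a : Fin n → ℂ} (ha : ∑ j, ‖a j‖ ^ 2 = 1)
    (x y : Fock n) :
    Filter.Tendsto (fun m : ℕ => ⟪y, (lin a ^ m) x⟫_ℂ) Filter.atTop (𝓝 0) := by
  rw [Metric.tendsto_atTop]
  intro ε hε
  have hδ : 0 < ε / (‖x‖ + 1) := by positivity
  obtain ⟨s, hs⟩ := ((Metric.tendsto_nhds.1 (hasSum_wordVec y)) _ hδ).exists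
  obtain ⟨N, hN⟩ : ∃ N, ∀ w ∈ s, w.length < N :=
    ⟨s.sup List.length + 1, fun w hw => Nat.lt_succ_of_le (Finset.le_sup hw)⟩
  refine ⟨N, fun m hm => ?_⟩
  have h0 : ⟪∑ w ∈ s, y w • wordVec w, (lin a ^ m) x⟫_ℂ = 0 := by
    rw [sum_inner]
    refine Finset.sum_eq_zero fun w hw => ?_
    rw [inner_smul_left, wordVec, lp.inner_single_left,
      lin_pow_apply_eq_zero _ _ _ _ ((hN w hw).trans_le hm)]
    simp
  have h1 : ⟪y, (lin a ^ m) x⟫_ℂ = ⟪y - ∑ w ∈ s, y w • wordVec w, (lin a ^ m) x⟫_ℂ := by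
    rw [inner_sub_left, h0, sub_zero]
  rw [dist_zero_right, h1]
  refine (norm_inner_le_norm _ _).trans_lt ?_
  rw [norm_lin_pow_apply ha, ← dist_eq_norm, dist_comm]
  calc _ ≤ ε / (‖x‖ + 1) * ‖x‖ := mul_le_mul_of_nonneg_right hs.le (norm_nonneg _)
    _ < ε / (‖x‖ + 1) * (‖x‖ + 1) := by
        refine mul_lt_mul_of_pos_left ?_ hδ
        linarith
    _ = ε := by field_simp

theorem tendsto_linElt_pow {n : ℕ} {a : Fin n → ℂ} (ha : ∑ j, ‖a j‖ ^ 2 = 1) :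
    Filter.Tendsto (fun m : ℕ => linElt a ^ m) Filter.atTop (𝓝 0) := by
  refine tendsto_subtype_rng.2 ?_
  refine ContinuousLinearMapWOT.tendsto_iff_forall_inner_apply_tendsto.2 fun x y => ?_
  have h : ∀ m : ℕ, (linElt a ^ m).1 x = (lin a ^ m) x := fun m => by
    rw [← linElt_toCLM, ← ContinuousLinearMapWOT.toCLM_pow]
    rfl
  simp only [h]
  simpa using tendsto_inner_lin_pow ha x y

/-- The weak* continuous characters of `F_n^∞` are the evaluations at the points of the ball. -/
theorem exists_eq_evalAt {n : ℕ} {f : HardyAlg n →ₐ[ℂ] ℂ} (hf : Continuous f) :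
    ∃ z : Ball n, f = evalAt z := by
  set c : EuclideanSpace ℂ (Fin n) := WithLp.toLp 2 fun j => f (gen j) with hc
  have hlt : ‖c‖ < 1 := by
    -- Were ‖c‖ ≥ 1, the character would take the value ‖c‖ on the combination with unit
    -- coefficients conj c / ‖c‖, whose powers tend to 0 weak*, while ‖c‖^m ≥ 1.
    by_contra hge
    rw [not_lt] at hge
    have hc0 : ‖c‖ ≠ 0 := by linarith
    set a : Fin n → ℂ := fun j => conj (c j) / ‖c‖ with ha
    have ha1 : ∑ j, ‖a j‖ ^ 2 = 1 := by
      simp only [ha, norm_div, div_pow, RCLike.norm_conj, Complex.norm_real, norm_norm]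
      rw [← Finset.sum_div, ← EuclideanSpace.norm_sq_eq]
      exact div_self (pow_ne_zero 2 hc0)
    have h1 : f (linElt a) = ‖c‖ := by
      rw [← conj_mul_div_norm c]
      simp [linElt, ha, hc]
    have h2 := (hf.tendsto 0).comp (tendsto_linElt_pow ha1)
    simp only [Function.comp_def, map_pow, h1, map_zero] at h2
    have h3 := h2.norm
    simp only [norm_pow, Complex.norm_real, norm_norm, norm_zero] at h3
    have h4 : (1 : ℝ) ≤ 0 := ge_of_tendsto' h3 fun m => one_le_pow₀ hge
    linarith
  refine ⟨⟨c, mem_ball_zero_iff.2 hlt⟩, hardyAlg_hom_ext hf (continuous_evalAt _) fun j => ?_⟩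
  rw [evalAt_gen]

/-- Weak* continuous endomorphisms of `F_n^∞ / 𝒩_Δ` for an orbit `Δ` are compositions with maps
of the orbit. -/
theorem exists_orbit_map {n : ℕ} {Γ : Subgroup (SU n)}
    (hΓ : Summable fun γ : Γ => 1 - ‖(γ.1 • Ball.origin n).1‖)
    {Φ : QuotAlg (orbit Γ) →ₐ[ℂ] QuotAlg (orbit Γ)}
    (hΦ : Continuous[quotWeakStar (orbit Γ), quotWeakStar (orbit Γ)] Φ) :
    ∃ θ : orbit Γ → orbit Γ, ∀ (a : QuotAlg (orbit Γ)) (z : orbit Γ),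
      quotEval z.1 z.2 (Φ a) = quotEval (θ z).1 (θ z).2 a := by
  have h : ∀ z : orbit Γ, ∃ w : orbit Γ, ∀ a : QuotAlg (orbit Γ),
      quotEval z.1 z.2 (Φ a) = quotEval w.1 w.2 a := by
    intro z
    let _ := quotWeakStar (orbit Γ)
    have h1 : Continuous fun a : QuotAlg (orbit Γ) => quotEval z.1 z.2 (Φ a) :=
      (continuous_quotEval z.1 z.2).comp hΦ
    obtain ⟨w, hw⟩ := exists_eq_evalAt
      (f := ((quotEval z.1 z.2).comp Φ).comp (quotMap (orbit Γ)))
      (h1.comp (continuous_quotMap (orbit Γ)))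
    -- The character factors through the quotient, so evaluation at w kills the ideal. Off the orbit
    -- this is impossible.
    have hwΔ : w ∈ orbit Γ := by
      by_contra hw'
      obtain ⟨φ, hφ, hφw⟩ := exists_evalAt_ne_zero hΓ hw'
      refine hφw ?_
      rw [← hw]
      have : quotMap (orbit Γ) φ = 0 := Ideal.Quotient.eq_zero_iff_mem.2 hφ
      simp [this]
    refine ⟨⟨w, hwΔ⟩, fun a => ?_⟩
    obtain ⟨φ, rfl⟩ := quotMap_surjective _ a
    exact DFunLike.congr_fun hw φ
  choose θ hθ using h
  exact ⟨θ, fun a z => hθ z a⟩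

/-! ### Pick matrices of row contractions -/

/-- A row `(φ₁, …, φₙ)` of elements of norm at most `C`, tested on the kernel vectors. -/
theorem sum_norm_sq_kernel_le {n m : ℕ} {φ : Fin n → HardyAlg n} {C : ℝ}
    (hφ : ∀ x : Fin n → Fock n, ‖∑ j, (φ j).1 (x j)‖ ^ 2 ≤ C ^ 2 * ∑ j, ‖x j‖ ^ 2)
    (z : Fin m → Ball n) (c : Fin m → ℂ) :
    ∑ j, ‖∑ b, (c b * conj (evalAt (z b) (φ j))) • kernelVec (z b)‖ ^ 2 ≤
      C ^ 2 * ‖∑ b, c b • kernelVec (z b)‖ ^ 2 := by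
  set h := ∑ b, c b • kernelVec (z b) with hh
  set g : Fin n → Fock n := fun j =>
    ∑ b, (c b * conj (evalAt (z b) (φ j))) • kernelVec (z b) with hg
  -- The adjoint of φ_j multiplies each kernel vector by the conjugate of its value, so g_j is the
  -- adjoint applied to h. The claim bounds the adjoint of the row.
  have key : ∀ j x, ⟪h, (φ j).1 x⟫_ℂ = ⟪g j, x⟫_ℂ := by
    intro j x
    simp only [hh, hg, sum_inner, inner_smul_left, map_mul, Complex.conj_conj]
    refine Finset.sum_congr rfl fun b _ => ?_
    rw [inner_kernelVec_apply _ (φ j).2 x]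
    exact (mul_assoc _ _ _).symm
  have h1 : ((∑ j, ‖g j‖ ^ 2 : ℝ) : ℂ) = ⟪h, ∑ j, (φ j).1 (g j)⟫_ℂ := by
    rw [inner_sum]
    push_cast
    refine Finset.sum_congr rfl fun j _ => ?_
    rw [key, inner_self_eq_norm_sq_to_K]
    rfl
  set G := ∑ j, ‖g j‖ ^ 2 with hG
  have hG0 : 0 ≤ G := Finset.sum_nonneg fun j _ => sq_nonneg _
  have h2 : G ≤ ‖h‖ * ‖∑ j, (φ j).1 (g j)‖ := by
    have := norm_inner_le_norm (𝕜 := ℂ) h (∑ j, (φ j).1 (g j))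
    rwa [← h1, Complex.norm_real, Real.norm_of_nonneg hG0] at this
  have h3 : G ^ 2 ≤ ‖h‖ ^ 2 * (C ^ 2 * G) := by
    calc G ^ 2 ≤ (‖h‖ * ‖∑ j, (φ j).1 (g j)‖) ^ 2 := pow_le_pow_left₀ hG0 h2 2
      _ = ‖h‖ ^ 2 * ‖∑ j, (φ j).1 (g j)‖ ^ 2 := mul_pow _ _ _
      _ ≤ _ := mul_le_mul_of_nonneg_left (hφ g) (sq_nonneg _)
  rcases hG0.eq_or_lt with h0 | h0
  · rw [← h0]
    positivity
  · have : G * G ≤ (C ^ 2 * ‖h‖ ^ 2) * G := by linarith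
    exact le_of_mul_le_mul_right this h0

/-- The square matrix with a given row and zeros elsewhere. -/
def rowMatrix {n : ℕ} {R : Type*} [Zero R] (i₀ : Fin n) (b : Fin n → R) :
    Matrix (Fin n) (Fin n) R :=
  Matrix.of fun i j => if i = i₀ then b j else 0

theorem rowMatrix_map {n : ℕ} {R S : Type*} [Zero R] [Zero S] (i₀ : Fin n) (b : Fin n → R)
    (f : R → S) (hf : f 0 = 0) :
    (rowMatrix i₀ b).map f = rowMatrix i₀ fun j => f (b j) := by
  ext i j
  simp only [rowMatrix, Matrix.map_apply, Matrix.of_apply]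
  split_ifs <;> simp [hf]

/-- The row of creation operators is isometric. It sits inside a square matrix because the matrix
norms are defined for square matrices. -/
theorem matrixNorm_rowMatrix_gen_le {n : ℕ} (i₀ : Fin n) :
    matrixNorm (rowMatrix i₀ (gen : Fin n → HardyAlg n)) ≤ 1 := by
  refine ContinuousLinearMap.opNorm_le_bound _ zero_le_one fun x => ?_
  rw [one_mul]
  refine (sq_le_sq₀ (norm_nonneg _) (norm_nonneg _)).1 ?_
  rw [PiLp.norm_sq_eq_of_L2, PiLp.norm_sq_eq_of_L2]
  have h : ∀ i, matrixOp (fun i j => (rowMatrix i₀ (gen : Fin n → HardyAlg n) i j).1.toCLM) x i =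
      if i = i₀ then ∑ j, creation j (x j) else 0 := by
    intro i
    refine (matrixOp_apply (fun i j => (rowMatrix i₀ (gen : Fin n → HardyAlg n) i j).1.toCLM)
      x i).trans ?_
    split_ifs with hi
    · refine Finset.sum_congr rfl fun j _ => ?_
      simp only [rowMatrix, Matrix.of_apply, hi, if_true]
      rfl
    · refine Finset.sum_eq_zero fun j _ => ?_
      simp only [rowMatrix, Matrix.of_apply, hi, if_false]
      rfl
  rw [Finset.sum_eq_single i₀]
  · rw [h, if_pos rfl, norm_sum_creation]
  · intro i _ hi
    rw [h, if_neg hi]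
    simp
  · simp

theorem norm_sum_row_le {n k : ℕ} (B : Matrix (Fin k) (Fin k) (HardyAlg n)) (i : Fin k)
    (x : Fin k → Fock n) :
    ‖∑ j, (B i j).1 (x j)‖ ^ 2 ≤ matrixNorm B ^ 2 * ∑ j, ‖x j‖ ^ 2 := by
  set y : PiLp 2 fun _ : Fin k => Fock n := WithLp.toLp 2 x
  have h1 := matrixOp_apply (fun i j => (B i j).1.toCLM) y i
  have h2 := PiLp.norm_apply_le (matrixOp (fun i j => (B i j).1.toCLM) y) i
  have h3 : ‖∑ j, (B i j).1 (x j)‖ ≤ matrixNorm B * ‖y‖ := by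
    rw [h1] at h2
    exact h2.trans (ContinuousLinearMap.le_opNorm _ _)
  calc _ ≤ (matrixNorm B * ‖y‖) ^ 2 := pow_le_pow_left₀ (norm_nonneg _) h3 2
    _ = _ := by rw [mul_pow, PiLp.norm_sq_eq_of_L2]

/-- The quotient norm is an infimum that need not be known to be attained, so lifts of norm below C
are used for each C > 1, and then C → 1. Values on Δ do not depend on the lift. -/
theorem sum_norm_sq_kernel_le_of_quotMatrixNorm_le {n m : ℕ} {Δ : Set (Ball n)} {i₀ : Fin n}
    {b : Fin n → QuotAlg Δ} (hb : quotMatrixNorm (rowMatrix i₀ b) ≤ 1)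
    (z : Fin m → Δ) (c : Fin m → ℂ) :
    ∑ j, ‖∑ s, (c s * conj (quotEval (z s).1 (z s).2 (b j))) • kernelVec (z s).1‖ ^ 2 ≤
      ‖∑ s, c s • kernelVec (z s).1‖ ^ 2 := by
  have hC : ∀ C : ℝ, 1 < C →
      ∑ j, ‖∑ s, (c s * conj (quotEval (z s).1 (z s).2 (b j))) • kernelVec (z s).1‖ ^ 2 ≤
        C ^ 2 * ‖∑ s, c s • kernelVec (z s).1‖ ^ 2 := by
    intro C hC
    obtain ⟨_, ⟨B, hB, rfl⟩, hBC⟩ :=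
      exists_lt_of_csInf_lt (quotMatrixNorm_set_nonempty _) (hb.trans_lt hC)
    have hrow : ∀ x : Fin n → Fock n,
        ‖∑ j, (B i₀ j).1 (x j)‖ ^ 2 ≤ C ^ 2 * ∑ j, ‖x j‖ ^ 2 := fun x =>
      (norm_sum_row_le B i₀ x).trans (mul_le_mul_of_nonneg_right
        (pow_le_pow_left₀ (matrixNorm_nonneg B) hBC.le 2)
        (Finset.sum_nonneg fun j _ => sq_nonneg _))
    have hbj : ∀ j s, quotEval (z s).1 (z s).2 (b j) = evalAt (z s).1 (B i₀ j) := by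
      intro j s
      have : quotMap Δ (B i₀ j) = b j := by
        have := congrFun (congrFun hB i₀) j
        simpa [rowMatrix] using this
      rw [← this, quotEval_quotMap]
    simp only [hbj]
    exact sum_norm_sq_kernel_le hrow (fun s => (z s).1) c
  have hlim : Filter.Tendsto (fun C : ℝ => C ^ 2 * ‖∑ s, c s • kernelVec (z s).1‖ ^ 2)
      (𝓝[>] 1) (𝓝 (1 ^ 2 * ‖∑ s, c s • kernelVec (z s).1‖ ^ 2)) :=
    tendsto_nhdsWithin_of_tendsto_nhds
      (((continuous_id.pow 2).mul continuous_const).tendsto 1)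
  have := ge_of_tendsto hlim (by
    filter_upwards [self_mem_nhdsWithin] with C h
    exact hC C h)
  simpa using this

/-- The Pick matrix of a row contraction is positive semidefinite. -/
theorem posSemidef_pick {n m : ℕ} {z : Fin m → Ball n} {v : Fin m → Fin n → ℂ}
    (h : ∀ c : Fin m → ℂ, ∑ j, ‖∑ s, (c s * conj (v s j)) • kernelVec (z s)‖ ^ 2 ≤
      ‖∑ s, c s • kernelVec (z s)‖ ^ 2) :
    (Matrix.of fun a b => (1 - ∑ j, v a j * conj (v b j)) *
      ⟪kernelVec (z a), kernelVec (z b)⟫_ℂ).PosSemidef := by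
  refine Matrix.PosSemidef.of_dotProduct_mulVec_nonneg ?_ fun c => ?_
  · ext a b
    simp only [Matrix.conjTranspose_apply, Matrix.of_apply, RCLike.star_def, map_mul, map_sub,
      map_one, map_sum, Complex.conj_conj, inner_conj_symm]
    congr 2
    exact Finset.sum_congr rfl fun j _ => mul_comm _ _
  · have e : star c ⬝ᵥ (Matrix.of fun a b => (1 - ∑ j, v a j * conj (v b j)) *
        ⟪kernelVec (z a), kernelVec (z b)⟫_ℂ).mulVec c =
        ((‖∑ s, c s • kernelVec (z s)‖ ^ 2 -
          ∑ j, ‖∑ s, (c s * conj (v s j)) • kernelVec (z s)‖ ^ 2 : ℝ) : ℂ) := by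
      have hsq : ∀ x : Fock n, ((‖x‖ : ℂ)) ^ 2 = ⟪x, x⟫_ℂ := fun x => by
        rw [inner_self_eq_norm_sq_to_K]; rfl
      have hin : ∀ α : Fin m → ℂ, ⟪∑ s, α s • kernelVec (z s), ∑ s, α s • kernelVec (z s)⟫_ℂ =
          ∑ a, ∑ b, conj (α a) * α b * ⟪kernelVec (z a), kernelVec (z b)⟫_ℂ := fun α => by
        rw [sum_inner]
        refine Finset.sum_congr rfl fun a _ => ?_
        rw [inner_sum]
        refine Finset.sum_congr rfl fun b _ => ?_
        rw [inner_smul_left, inner_smul_right]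
        ring
      push_cast
      simp only [hsq, hin]
      rw [Finset.sum_comm (γ := Fin n), ← Finset.sum_sub_distrib]
      simp only [dotProduct, Matrix.mulVec, Matrix.of_apply, Pi.star_apply, RCLike.star_def]
      refine Finset.sum_congr rfl fun a _ => ?_
      rw [Finset.sum_comm (γ := Fin n), ← Finset.sum_sub_distrib, Finset.mul_sum]
      refine Finset.sum_congr rfl fun b _ => ?_
      simp only [sub_mul, mul_sub, Finset.sum_mul, Finset.mul_sum, map_mul, Complex.conj_conj]
      congr 1
      · ring
      · exact Finset.sum_congr rfl fun j _ => by ring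
    rw [e]
    exact Complex.zero_le_real.2 (sub_nonneg.2 (h c))

/-! ### The kernel of the ball -/

/-- The function `1 - ⟨z, w⟩` on the ball. -/
def ballForm {n : ℕ} (z w : Ball n) : ℂ := 1 - ∑ j, z.1 j * conj (w.1 j)

theorem kernelVec_eq {n : ℕ} (w : Ball n) :
    kernelVec w = vacuum n + ∑ j, conj (w.1 j) • creation j (kernelVec w) := by
  rw [← lin_apply]
  ext v
  change _ = vacuum n v + lin (fun j => conj (w.1 j)) (kernelVec w) v
  rcases v with _ | ⟨i, v⟩
  · rw [lin_apply_nil, show vacuum n = wordVec [] from rfl, wordVec_apply]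
    simp [kernelVec, monomial]
  · rw [lin_apply_cons, show vacuum n = wordVec [] from rfl, wordVec_apply]
    simp [kernelVec, monomial]

/-- The kernel vector satisfies k_w = vacuum + ∑ conj(w_j) S_j k_w. Pairing with k_z gives a linear
equation for ⟪k_z, k_w⟫, in place of summing over words. -/
theorem inner_kernelVec_mul_ballForm {n : ℕ} (z w : Ball n) :
    ⟪kernelVec z, kernelVec w⟫_ℂ * ballForm z w = 1 := by
  have h : ⟪kernelVec z, kernelVec w⟫_ℂ =
      1 + ∑ j, conj (w.1 j) * (z.1 j * ⟪kernelVec z, kernelVec w⟫_ℂ) := by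
    conv_lhs => rw [kernelVec_eq w]
    rw [inner_add_right, inner_kernelVec_vacuum, inner_sum]
    simp only [inner_smul_right, inner_kernelVec_creation]
  have h2 : ∑ j, conj (w.1 j) * (z.1 j * ⟪kernelVec z, kernelVec w⟫_ℂ) =
      (∑ j, z.1 j * conj (w.1 j)) * ⟪kernelVec z, kernelVec w⟫_ℂ := by
    rw [Finset.sum_mul]
    exact Finset.sum_congr rfl fun j _ => by ring
  rw [h2] at h
  rw [ballForm]
  linear_combination h

theorem ballForm_ne_zero {n : ℕ} (z w : Ball n) : ballForm z w ≠ 0 :=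
  right_ne_zero_of_mul_eq_one (inner_kernelVec_mul_ballForm z w)

theorem inner_kernelVec_kernelVec {n : ℕ} (z w : Ball n) :
    ⟪kernelVec z, kernelVec w⟫_ℂ = (ballForm z w)⁻¹ :=
  eq_inv_of_mul_eq_one_left (inner_kernelVec_mul_ballForm z w)

theorem conj_ballForm {n : ℕ} (z w : Ball n) : conj (ballForm z w) = ballForm w z := by
  simp only [ballForm, map_sub, map_one, map_sum, map_mul, Complex.conj_conj]
  congr 1
  exact Finset.sum_congr rfl fun j _ => mul_comm _ _

/-! ### Kernels that are positive together with their inverses -/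

/-- The 2 × 2 minors of K give |K_ab|² ≤ K_aa K_bb, and those of its entrywise inverse give the
opposite inequality. -/
theorem mul_eq_mul_of_posSemidef_inv {ι : Type*} {K : Matrix ι ι ℂ} (h0 : ∀ a b, K a b ≠ 0)
    (hK : K.PosSemidef) (hK' : (K.map fun x => x⁻¹).PosSemidef) (a b : ι) :
    K a b * K b a = K a a * K b b := by
  have hd := (hK.submatrix ![a, b]).det_nonneg
  have hd' := (hK'.submatrix ![a, b]).det_nonneg
  simp only [Matrix.det_fin_two, Matrix.submatrix_apply, Matrix.map_apply, Matrix.cons_val_zero,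
    Matrix.cons_val_one] at hd hd'
  have hab : K a b * K b a = ((‖K a b‖ ^ 2 : ℝ) : ℂ) := by
    rw [← hK.1.apply b a, RCLike.star_def, Complex.mul_conj']
    norm_cast
  have hpos : 0 < K a a * K b b :=
    mul_pos (hK.diag_nonneg.lt_of_ne' (h0 a a)) (hK.diag_nonneg.lt_of_ne' (h0 b b))
  obtain ⟨r, hr⟩ : ∃ r : ℝ, K a a * K b b = r :=
    ⟨_, Complex.eq_re_of_ofReal_le (r := 0) (by simpa using hpos.le)⟩
  rw [← mul_inv, ← mul_inv, hab, hr, ← Complex.ofReal_inv, ← Complex.ofReal_inv,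
    ← Complex.ofReal_sub, Complex.zero_le_real, sub_nonneg] at hd'
  rw [hab, hr, ← Complex.ofReal_sub, Complex.zero_le_real, sub_nonneg] at hd
  rw [hr, Complex.zero_lt_real] at hpos
  have hn : 0 < ‖K a b‖ ^ 2 := pow_pos (norm_pos_iff.2 (h0 a b)) 2
  rw [hab, hr, le_antisymm hd ((inv_le_inv₀ hn hpos).1 hd')]

/-- Let p be the cyclic product of off-diagonal entries and R the product of the diagonal. Equality
in the 2 × 2 minors gives |p| = R and det K = 2 Re p - 2R. Positivity of the determinant then forces
p = R, which fixes the phases. -/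
theorem rank_one_of_posSemidef_inv {K : Matrix (Fin 3) (Fin 3) ℂ} (h0 : ∀ a b, K a b ≠ 0)
    (hK : K.PosSemidef) (hK' : (K.map fun x => x⁻¹).PosSemidef) :
    K 0 1 * K 2 2 = K 0 2 * K 2 1 := by
  have h2 := mul_eq_mul_of_posSemidef_inv h0 hK hK'
  have hpos : ∀ a, ∃ r : ℝ, 0 < r ∧ K a a = r := fun a =>
    ⟨(K a a).re, (Complex.pos_iff.1 (hK.diag_nonneg.lt_of_ne' (h0 a a))).1,
      Complex.eq_re_of_ofReal_le (r := 0) (by simpa using hK.diag_nonneg)⟩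
  choose r hr hKr using hpos
  set p := K 0 1 * K 1 2 * K 2 0 with hp
  have hconj : K 0 2 * K 1 0 * K 2 1 = conj p := by
    rw [hp, map_mul, map_mul, ← RCLike.star_def, hK.1.apply, hK.1.apply, hK.1.apply]
    ring
  have hdet := hK.det_nonneg
  have hdet' : K.det = ((2 * p.re - 2 * (r 0 * r 1 * r 2) : ℝ) : ℂ) := by
    have hre : ((p.re : ℝ) : ℂ) * 2 = p + conj p := by
      rw [Complex.add_conj]; push_cast; ring
    rw [Matrix.det_fin_three]
    push_cast
    rw [← hKr, ← hKr, ← hKr]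
    linear_combination -hre + hconj - K 2 2 * h2 0 1 - K 0 0 * h2 1 2 - K 1 1 * h2 0 2
  rw [hdet', Complex.zero_le_real] at hdet
  have hn : p * conj p = ((r 0 * r 1 * r 2) ^ 2 : ℝ) := by
    rw [← hconj]
    push_cast
    rw [← hKr, ← hKr, ← hKr]
    calc p * (K 0 2 * K 1 0 * K 2 1) =
        (K 0 1 * K 1 0) * (K 1 2 * K 2 1) * (K 0 2 * K 2 0) := by rw [hp]; ring
      _ = _ := by rw [h2, h2, h2]; ring
  rw [Complex.mul_conj, Complex.ofReal_inj, Complex.normSq_apply] at hn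
  have hR : 0 < r 0 * r 1 * r 2 := mul_pos (mul_pos (hr 0) (hr 1)) (hr 2)
  have him : p.im = 0 := by nlinarith [mul_self_nonneg p.im]
  have hre : p.re = r 0 * r 1 * r 2 := by nlinarith [mul_self_nonneg p.im]
  have hpR : p = K 0 0 * K 1 1 * K 2 2 := by
    rw [hKr, hKr, hKr]
    apply Complex.ext <;> simp [him, hre]
  refine mul_right_cancel₀ (mul_ne_zero (h0 1 2) (h0 2 0)) ?_
  calc K 0 1 * K 2 2 * (K 1 2 * K 2 0) = p * K 2 2 := by rw [hp]; ring
    _ = (K 0 0 * K 2 2) * (K 1 1 * K 2 2) := by rw [hpR]; ring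
    _ = _ := by rw [← h2, ← h2]; ring

/-- Maps of a set of points of the ball that distort the form `1 - ⟨z, w⟩` positively in both
directions. -/
theorem ballForm_mul_of_posSemidef {n : ℕ} {ι : Type*} {z w : ι → Ball n}
    (h : ∀ p : Fin 3 → ι, (Matrix.of fun a b =>
      ballForm (w (p a)) (w (p b)) * (ballForm (z (p a)) (z (p b)))⁻¹).PosSemidef)
    (h' : ∀ p : Fin 3 → ι, (Matrix.of fun a b =>
      ballForm (z (p a)) (z (p b)) * (ballForm (w (p a)) (w (p b)))⁻¹).PosSemidef) (o : ι) :
    ∃ f : ι → ℂ, (∀ a, f a ≠ 0) ∧ ∀ a b,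
      ballForm (w a) (w b) = f a * conj (f b) * ballForm (z a) (z b) := by
  set K : ι → ι → ℂ := fun a b => ballForm (w a) (w b) * (ballForm (z a) (z b))⁻¹ with hKdef
  have hK0 : ∀ a b, K a b ≠ 0 := fun a b =>
    mul_ne_zero (ballForm_ne_zero _ _) (inv_ne_zero (ballForm_ne_zero _ _))
  have hrank : ∀ a b, K a b * K o o = K a o * K o b := by
    intro a b
    have := rank_one_of_posSemidef_inv (K := Matrix.of fun s t => K (![a, b, o] s) (![a, b, o] t))
      (fun s t => hK0 _ _) (h ![a, b, o]) (by
        convert h' ![a, b, o] using 1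
        ext s t
        simp only [Matrix.map_apply, Matrix.of_apply, hKdef, mul_inv, inv_inv]
        exact mul_comm _ _)
    simpa using this
  have hKc : ∀ a b, conj (K a b) = K b a := fun a b => by
    simp only [hKdef, map_mul, map_inv₀, conj_ballForm]
  have hpos : 0 < K o o := by
    have h1 : 0 ≤ K o o := (h fun _ => o).diag_nonneg (i := 0)
    exact h1.lt_of_ne' (hK0 o o)
  obtain ⟨r, hr⟩ : ∃ r : ℝ, K o o = r :=
    ⟨_, Complex.eq_re_of_ofReal_le (r := 0) (by simpa using hpos.le)⟩
  rw [hr, Complex.zero_lt_real] at hpos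
  have hsq : ((√r : ℝ) : ℂ) * ((√r : ℝ) : ℂ) = r := by
    rw [← Complex.ofReal_mul, Real.mul_self_sqrt hpos.le]
  have hs0 : ((√r : ℝ) : ℂ) ≠ 0 := by exact_mod_cast (Real.sqrt_pos.2 hpos).ne'
  have hr0 : (r : ℂ) ≠ 0 := by exact_mod_cast hpos.ne'
  -- Rank one gives K(a,b) = K(a,o) K(o,b) / K(o,o), and dividing by the root of K(o,o) splits this
  -- symmetrically.
  refine ⟨fun a => K a o / (√r : ℝ), fun a => div_ne_zero (hK0 _ _) hs0, fun a b => ?_⟩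
  have h1 : K a o / (√r : ℝ) * conj (K b o / (√r : ℝ)) = K a b := by
    rw [map_div₀, hKc, Complex.conj_ofReal, div_mul_div_comm, hsq, div_eq_iff hr0, ← hrank, hr]
  rw [h1]
  exact (inv_mul_cancel_right₀ (ballForm_ne_zero _ _) _).symm

/-! ### Extension of partial isometries of the form -/

/-- A map between families of vectors that preserves a nondegenerate sesquilinear form extends to
a linear isometry of the form, if the first family spans. -/
theorem exists_matrix_of_form_eq {m ι : Type*} [Fintype m] [DecidableEq m] {J : Matrix m m ℂ}
    (hJ : IsUnit J) {v u : ι → m → ℂ} (hv : Submodule.span ℂ (Set.range v) = ⊤)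
    (h : ∀ a b, star (u a) ⬝ᵥ J.mulVec (u b) = star (v a) ⬝ᵥ J.mulVec (v b)) :
    ∃ M : Matrix m m ℂ, M.conjTranspose * J * M = J ∧ ∀ a, M.mulVec (v a) = u a := by
  obtain ⟨p, hp⟩ : ∃ p : m → ι, LinearIndependent ℂ (v ∘ p) := by
    obtain ⟨f, hf, -, hlin⟩ := Submodule.exists_fun_fin_finrank_span_eq ℂ (Set.range v)
    have hcard : Fintype.card m = Module.finrank ℂ (Submodule.span ℂ (Set.range v)) := by
      rw [hv, finrank_top, Module.finrank_fintype_fun_eq_card]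
    choose q hq using hf
    let e : m ≃ Fin (Module.finrank ℂ (Submodule.span ℂ (Set.range v))) :=
      Fintype.equivFinOfCardEq hcard
    refine ⟨q ∘ e, ?_⟩
    have : v ∘ (q ∘ e) = f ∘ e := funext fun i => hq (e i)
    rw [this]
    exact hlin.comp _ e.injective
  set P : Matrix m m ℂ := Matrix.of fun i a => v (p a) i with hP
  set Q : Matrix m m ℂ := Matrix.of fun i a => u (p a) i with hQ
  have hPu : IsUnit P := Matrix.linearIndependent_cols_iff_isUnit.1 hp
  have hPa : ∀ x : m → ℂ, (P.conjTranspose * J).mulVec x = fun b => star (v (p b)) ⬝ᵥ J.mulVec x :=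
    fun x => by
      rw [← Matrix.mulVec_mulVec]
      rfl
  have hQa : ∀ x : m → ℂ, (Q.conjTranspose * J).mulVec x = fun b => star (u (p b)) ⬝ᵥ J.mulVec x :=
    fun x => by
      rw [← Matrix.mulVec_mulVec]
      rfl
  -- Equal Gram matrices make the vectors u_(p b) a basis too. The matrix Q P⁻¹ is then correct on
  -- every v_a, because the pairings with this basis determine a vector.
  have hPQ : Q.conjTranspose * J * Q = P.conjTranspose * J * P := by
    ext b a
    have h1 := congrFun (hQa (u (p a))) b
    have h2 := congrFun (hPa (v (p a))) b
    exact h1.trans ((h (p b) (p a)).trans h2.symm)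
  have hPJ : IsUnit (P.conjTranspose * J * P) :=
    ((Matrix.isUnit_conjTranspose _).2 hPu |>.mul hJ).mul hPu
  have hQu : IsUnit (Q.conjTranspose * J) := by
    rw [← hPQ] at hPJ
    rw [Matrix.isUnit_iff_isUnit_det, Matrix.det_mul] at hPJ
    exact (Matrix.isUnit_iff_isUnit_det _).2 (isUnit_of_mul_isUnit_left hPJ)
  have hPi : P * P⁻¹ = 1 := Matrix.mul_nonsing_inv _ ((Matrix.isUnit_iff_isUnit_det _).1 hPu)
  have hPi' : P⁻¹.conjTranspose * P.conjTranspose = 1 := by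
    rw [← Matrix.conjTranspose_mul, hPi, Matrix.conjTranspose_one]
  refine ⟨Q * P⁻¹, ?_, fun a => ?_⟩
  · calc (Q * P⁻¹).conjTranspose * J * (Q * P⁻¹) =
        P⁻¹.conjTranspose * (Q.conjTranspose * J * Q) * P⁻¹ := by
          rw [Matrix.conjTranspose_mul]
          simp only [Matrix.mul_assoc]
      _ = (P⁻¹.conjTranspose * P.conjTranspose) * J * (P * P⁻¹) := by
          rw [hPQ]
          simp only [Matrix.mul_assoc]
      _ = J := by rw [hPi, hPi', Matrix.one_mul, Matrix.mul_one]
  · refine Matrix.mulVec_injective_of_isUnit hQu ?_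
    rw [Matrix.mulVec_mulVec, ← Matrix.mul_assoc, hPQ, Matrix.mul_assoc, hPi, Matrix.mul_one,
      hPa, hQa]
    exact funext fun b => (h (p b) a).symm

theorem star_homog_form {n : ℕ} (z w : Ball n) :
    star (homog z.1) ⬝ᵥ (formMatrix n).mulVec (homog w.1) = -ballForm w z := by
  simp only [formMatrix, Matrix.mulVec_diagonal, dotProduct, Fintype.sum_sum_type, homog,
    Pi.star_apply, Sum.elim_inl, Sum.elim_inr, RCLike.star_def, ballForm]
  simp [mul_comm, sub_eq_add_neg]

/-- Subtracting (0, 1), which belongs to the family as 0 ∈ Δ, leaves the vectors (z, 0). -/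
theorem span_homog_eq_top {n : ℕ} {Δ : Set (Ball n)} (h0 : Ball.origin n ∈ Δ)
    (hspan : Submodule.span ℂ (Subtype.val '' Δ) = ⊤) :
    Submodule.span ℂ (Set.range fun z : Δ => homog z.1.1) = ⊤ := by
  set W := Submodule.span ℂ (Set.range fun z : Δ => homog z.1.1)
  let L : EuclideanSpace ℂ (Fin n) →ₗ[ℂ] (Fin n ⊕ Unit → ℂ) :=
    { toFun := fun z => Sum.elim (fun i => z i) fun _ => 0
      map_add' := fun x y => by ext i; rcases i with i | i <;> simp
      map_smul' := fun c x => by ext i; rcases i with i | i <;> simp }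
  have hL : ∀ z : EuclideanSpace ℂ (Fin n), homog z = L z + homog (Ball.origin n).1 := by
    intro z
    ext i
    rcases i with i | i <;> simp [L, homog, Ball.origin]
  have ho : homog (Ball.origin n).1 ∈ W := Submodule.subset_span ⟨⟨_, h0⟩, rfl⟩
  have hLW : ∀ z, L z ∈ W := by
    have hle : Submodule.span ℂ (Subtype.val '' Δ) ≤ W.comap L := by
      refine Submodule.span_le.2 ?_
      rintro _ ⟨z, hz, rfl⟩
      have h1 : homog z.1 ∈ W := Submodule.subset_span ⟨⟨z, hz⟩, rfl⟩
      rw [hL] at h1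
      exact (Submodule.add_mem_iff_left _ ho).1 h1
    intro z
    exact hle (hspan ▸ Submodule.mem_top)
  refine Submodule.eq_top_iff'.2 fun x => ?_
  have hx : x = L (WithLp.toLp 2 fun i => x (Sum.inl i)) +
      x (Sum.inr ()) • homog (Ball.origin n).1 := by
    ext i
    rcases i with i | i <;> simp [L, homog, Ball.origin]
  rw [hx]
  exact W.add_mem (hLW _) (W.smul_mem _ ho)

/-- A matrix that preserves the form is a multiple of an element of `SU(n,1)`. -/
theorem exists_su_smul {n : ℕ} {M : Mat n}
    (hM : M.conjTranspose * formMatrix n * M = formMatrix n) :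
    ∃ (γ : SU n) (ω : ℂ), ω ≠ 0 ∧ toMat γ = ω • M := by
  have hJ : (formMatrix n).det ≠ 0 := by
    have := congrArg Matrix.det (formMatrix_mul_self n)
    rw [Matrix.det_mul, Matrix.det_one] at this
    exact left_ne_zero_of_mul_eq_one this
  have hdet : conj M.det * M.det = 1 := by
    have := congrArg Matrix.det hM
    rw [Matrix.det_mul, Matrix.det_mul, Matrix.det_conjTranspose, RCLike.star_def] at this
    refine mul_left_cancel₀ hJ ?_
    linear_combination this
  have hcard : Fintype.card (Fin n ⊕ Unit) ≠ 0 := by simp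
  -- An (n+1)-st root of conj(det M), which is the inverse of det M, normalizes the determinant. It
  -- is unimodular, so the form is still preserved.
  obtain ⟨ω, hω⟩ := IsAlgClosed.exists_pow_nat_eq (conj M.det) (Nat.pos_of_ne_zero hcard)
  have hnorm : ‖ω‖ = 1 := by
    have h1 : ‖M.det‖ * ‖M.det‖ = 1 := by
      have := congrArg norm hdet
      rwa [norm_mul, RCLike.norm_conj, norm_one] at this
    have h2 : ‖M.det‖ = 1 := by nlinarith [norm_nonneg M.det]
    have h3 := congrArg norm hω
    rw [norm_pow, RCLike.norm_conj, h2] at h3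
    exact (pow_eq_one_iff_of_nonneg (norm_nonneg _) hcard).1 h3
  have hω0 : ω ≠ 0 := norm_ne_zero_iff.1 (by rw [hnorm]; exact one_ne_zero)
  have hωω : conj ω * ω = 1 := by rw [Complex.conj_mul', hnorm]; simp
  refine ⟨⟨⟨ω • M, ?_⟩, ?_⟩, ω, hω0, rfl⟩
  · rw [Matrix.det_smul, hω, hdet]
  · change (ω • M).conjTranspose * formMatrix n * (ω • M) = formMatrix n
    rw [Matrix.conjTranspose_smul, Matrix.smul_mul, Matrix.smul_mul, Matrix.mul_smul, smul_smul,
      hM, RCLike.star_def, hωω, one_smul]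

theorem smul_eq_of_mulVec_homog {n : ℕ} {γ : SU n} {z w : Ball n} {c : ℂ}
    (h : (toMat γ).mulVec (homog z.1) = c • homog w.1) : γ • z = w := by
  have hd : denom γ z.1 = c := by
    rw [denom, h]
    simp [homog]
  have hc : c ≠ 0 := hd ▸ denom_ne_zero γ z
  refine Subtype.ext (PiLp.ext fun i => ?_)
  change (toMat γ).mulVec (homog z.1) (Sum.inl i) / denom γ z.1 = w.1 i
  rw [h, hd]
  simp [homog, hc]

/-- A map of a spanning set of points of the ball that distorts the form by a rank one factor is
given by an element of `SU(n,1)`. -/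
theorem exists_su_of_ballForm {n : ℕ} {Δ : Set (Ball n)} (h0 : Ball.origin n ∈ Δ)
    (hspan : Submodule.span ℂ (Subtype.val '' Δ) = ⊤) {θ : Δ → Ball n} {f : Δ → ℂ}
    (hf : ∀ a, f a ≠ 0)
    (h : ∀ a b, ballForm (θ a) (θ b) = f a * conj (f b) * ballForm a.1 b.1) :
    ∃ γ : SU n, ∀ z : Δ, γ • z.1 = θ z := by
  have hJ : IsUnit (formMatrix n) :=
    IsUnit.of_mul_eq_one _ (formMatrix_mul_self n)
  obtain ⟨M, hM, hMv⟩ := exists_matrix_of_form_eq hJ (span_homog_eq_top h0 hspan)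
    -- Rescaling the representatives absorbs the rank one factor and does not change the points of
    -- the ball.
    (u := fun z => (f z)⁻¹ • homog (θ z).1) (fun a b => by
      rw [star_smul, Matrix.mulVec_smul, smul_dotProduct, dotProduct_smul, star_homog_form,
        star_homog_form, h, smul_eq_mul, smul_eq_mul, RCLike.star_def, map_inv₀]
      have h1 := hf b
      have h2 : conj (f a) ≠ 0 := (map_ne_zero _).2 (hf a)
      field_simp)
  obtain ⟨γ, ω, hω, hγ⟩ := exists_su_smul hM
  refine ⟨γ, fun z => smul_eq_of_mulVec_homog (c := ω * (f z)⁻¹) ?_⟩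
  rw [hγ, Matrix.smul_mulVec, hMv, smul_smul]

/-! ### The automorphisms of `F_n^∞ / 𝒩_Δ` -/

/-- A weak* continuous completely isometric automorphism for an orbit is a composition with an
element of `SU(n,1)`. -/
theorem exists_su_of_mem_weakStarAut {n : ℕ} (hn : 0 < n) {Γ : Subgroup (SU n)}
    (hΓ : Summable fun γ : Γ => 1 - ‖(γ.1 • Ball.origin n).1‖)
    (hspan : Submodule.span ℂ (Subtype.val '' orbit Γ) = ⊤)
    {Φ : QuotAlg (orbit Γ) ≃ₐ[ℂ] QuotAlg (orbit Γ)} (hΦ : Φ ∈ weakStarAut (orbit Γ)) :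
    ∃ γ : orbitStabilizer Γ, ∀ (a : QuotAlg (orbit Γ)) (z : Ball n) (hz : z ∈ orbit Γ),
      quotEval z hz (Φ a) = quotEval (γ.1 • z) (smul_mem_orbit γ hz) a := by
  obtain ⟨θ, hθ⟩ := exists_orbit_map hΓ (Φ := Φ.toAlgHom) hΦ.1
  have hθ' : ∀ (a : QuotAlg (orbit Γ)) (z : orbit Γ),
      quotEval z.1 z.2 (Φ a) = quotEval (θ z).1 (θ z).2 a := hθ
  let i₀ : Fin n := ⟨0, hn⟩
  set s : Fin n → QuotAlg (orbit Γ) := fun j => quotMap (orbit Γ) (gen j) with hs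
  have hs_eval : ∀ (z : orbit Γ) j, quotEval z.1 z.2 (s j) = z.1.1 j := fun z j => by
    rw [hs, quotEval_quotMap, evalAt_gen]
  have hrow : quotMatrixNorm (rowMatrix i₀ s) ≤ 1 := by
    have h1 := quotMatrixNorm_le (Δ := orbit Γ) (rowMatrix i₀ (gen : Fin n → HardyAlg n))
    rw [rowMatrix_map _ _ _ (map_zero (quotMap (orbit Γ)))] at h1
    exact h1.trans (matrixNorm_rowMatrix_gen_le i₀)
  have hrow1 : quotMatrixNorm (rowMatrix i₀ fun j => Φ (s j)) ≤ 1 := by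
    rw [← rowMatrix_map i₀ s Φ (map_zero _), hΦ.2]
    exact hrow
  -- The inverse inherits isometry from Φ. At θ(z) the elements Φ⁻¹(S_j) take the values z_j, so the
  -- Pick matrix at the points θ(z) is the entrywise inverse of the first one.
  have hrow2 : quotMatrixNorm (rowMatrix i₀ fun j => Φ.symm (s j)) ≤ 1 := by
    rw [← hΦ.2, rowMatrix_map _ _ Φ (map_zero _)]
    simpa only [AlgEquiv.apply_symm_apply] using hrow
  have hK1 : ∀ p : Fin 3 → orbit Γ, (Matrix.of fun a b =>
      ballForm (θ (p a)).1 (θ (p b)).1 * (ballForm (p a).1 (p b).1)⁻¹).PosSemidef := by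
    intro p
    have h1 := posSemidef_pick (z := fun a => (p a).1)
      (v := fun a j => quotEval (p a).1 (p a).2 (Φ (s j)))
      (sum_norm_sq_kernel_le_of_quotMatrixNorm_le hrow1 p)
    simp only [hθ', hs_eval, inner_kernelVec_kernelVec] at h1
    exact h1
  have hK2 : ∀ p : Fin 3 → orbit Γ, (Matrix.of fun a b =>
      ballForm (p a).1 (p b).1 * (ballForm (θ (p a)).1 (θ (p b)).1)⁻¹).PosSemidef := by
    intro p
    have h1 := posSemidef_pick (z := fun a => (θ (p a)).1)
      (v := fun a j => quotEval (θ (p a)).1 (θ (p a)).2 (Φ.symm (s j)))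
      (sum_norm_sq_kernel_le_of_quotMatrixNorm_le hrow2 fun a => θ (p a))
    simp only [← hθ', AlgEquiv.apply_symm_apply, hs_eval, inner_kernelVec_kernelVec] at h1
    exact h1
  obtain ⟨f, hf, hff⟩ := ballForm_mul_of_posSemidef (z := fun a : orbit Γ => a.1)
    (w := fun a => (θ a).1) hK1 hK2 ⟨_, origin_mem_orbit Γ⟩
  obtain ⟨γ, hγ⟩ := exists_su_of_ballForm (origin_mem_orbit Γ) hspan hf hff
  have hmem : γ ∈ orbitStabilizer Γ := (mem_orbitStabilizer_iff hΓ γ).2 fun z hz => by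
    rw [hγ ⟨z, hz⟩]
    exact (θ ⟨z, hz⟩).2
  exact ⟨⟨γ, hmem⟩, fun a z hz => (hθ' a ⟨z, hz⟩).trans (quotEval_congr (hγ ⟨z, hz⟩).symm _ _ _)⟩

/-- An element of `SU(n,1)` that fixes the origin and a spanning set acts trivially. -/
theorem smul_eq_of_fixes {n : ℕ} {Δ : Set (Ball n)} (h0 : Ball.origin n ∈ Δ)
    (hspan : Submodule.span ℂ (Subtype.val '' Δ) = ⊤) {γ : SU n} (h : ∀ z ∈ Δ, γ • z = z)
    (z : Ball n) : γ • z = z := by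
  have hd : blockD γ ≠ 0 := norm_pos_iff.1 (zero_lt_one.trans_le (one_le_norm_blockD γ))
  -- Fixing 0 gives b = 0 and then c = 0, so γ acts by the linear map A/d, which is the identity on
  -- a spanning set.
  have hB : ∀ j, blockB γ j = 0 := fun j => by
    have h1 := congrArg (fun w : Ball n => w.1 j) (h _ h0)
    simp only [coe_smul_ball, moebius_apply, denom_origin] at h1
    simpa [Ball.origin, hd] using h1
  have hC : ∀ k, blockC γ k = 0 := fun k => by
    have h1 := block_col_B γ k
    simp only [hB, map_zero, zero_mul, Finset.sum_const_zero] at h1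
    simpa [hd] using h1.symm
  let L : EuclideanSpace ℂ (Fin n) →ₗ[ℂ] EuclideanSpace ℂ (Fin n) :=
    { toFun := fun x => WithLp.toLp 2 fun j => (∑ k, blockA γ j k * x k) / blockD γ
      map_add' := fun x y => by
        ext j
        simp [mul_add, Finset.sum_add_distrib, add_div]
      map_smul' := fun c x => by
        ext j
        simp only [PiLp.smul_apply, smul_eq_mul, RingHom.id_apply]
        rw [← mul_div_assoc, Finset.mul_sum]
        congr 1
        exact Finset.sum_congr rfl fun k _ => by ring }
  have hL : ∀ w : Ball n, (γ • w).1 = L w.1 := fun w => by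
    ext j
    rw [coe_smul_ball, moebius_apply, denom_eq]
    simp [hB, hC, L]
  have hid : L = LinearMap.id := by
    refine LinearMap.ext_on hspan ?_
    rintro _ ⟨w, hw, rfl⟩
    rw [← hL, h w hw]
    rfl
  exact Subtype.ext (by rw [hL, hid]; rfl)

end NCHardy

end

/-! ### The main theorem. -/

open NCHardy
theorem mainTheorem1 (n : ℕ) (hn : 0 < n) (Γ : Subgroup (SU n)) [DiscreteTopology Γ]
    (hBlaschke : Summable fun γ : Γ => 1 - ‖(γ.1 • Ball.origin n).1‖)
    (hspan : Submodule.span ℂ (Subtype.val '' orbit Γ) = ⊤) :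
    (∀ γ : SU n, γ ∈ orbitStabilizer Γ ↔ ∀ z ∈ orbit Γ, γ • z ∈ orbit Γ) ∧
    ∃ τ : orbitStabilizer Γ →* (QuotAlg (orbit Γ) ≃ₐ[ℂ] QuotAlg (orbit Γ)),
      Set.range τ = weakStarAut (orbit Γ) ∧
      (∀ γ : orbitStabilizer Γ, τ γ = 1 ↔ ∀ z : Ball n, γ.1 • z = z) ∧
      (∀ (γ : orbitStabilizer Γ) (a : QuotAlg (orbit Γ)) (z : Ball n) (hz : z ∈ orbit Γ),
        quotEval (γ.1 • z) (smul_mem_orbit γ hz) (τ γ a) = quotEval z hz a) ∧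
      (∀ a : QuotAlg (orbit Γ),
        (∀ (γ : SU n) (hγ : γ ∈ Γ), τ ⟨γ, le_orbitStabilizer Γ hγ⟩ a = a) →
          ∃ c : ℂ, a = algebraMap ℂ (QuotAlg (orbit Γ)) c) := by
  obtain ⟨τ, hτ, hτ_mem⟩ : ∃ τ : orbitStabilizer Γ →*
      (QuotAlg (orbit Γ) ≃ₐ[ℂ] QuotAlg (orbit Γ)),
      (∀ (γ : orbitStabilizer Γ) (a : QuotAlg (orbit Γ)) (z : Ball n) (hz : z ∈ orbit Γ),
        quotEval (γ.1 • z) (smul_mem_orbit γ hz) (τ γ a) = quotEval z hz a) ∧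
      ∀ γ, τ γ ∈ weakStarAut (orbit Γ) :=
    ⟨quotAut (orbit Γ), fun γ a z hz => quotEval_quotAut γ a z hz _, quotAut_mem_weakStarAut⟩
  refine ⟨mem_orbitStabilizer_iff hBlaschke, τ, ?_, ?_, hτ, ?_⟩
  · refine Set.Subset.antisymm ?_ fun Φ hΦ => ?_
    · rintro _ ⟨γ, rfl⟩
      exact hτ_mem γ
    · obtain ⟨γ, hγ⟩ := exists_su_of_mem_weakStarAut hn hBlaschke hspan hΦ
      -- The inverse enters because Φ is composition with γ, whereas `τ` is composition with the
      -- inverse.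
      refine ⟨γ⁻¹, AlgEquiv.ext fun a => quotAlg_ext fun z hz => ?_⟩
      rw [hγ a z hz, ← hτ γ⁻¹ a _ (smul_mem_orbit γ hz)]
      exact quotEval_congr (by simp) _ _ _
  · refine fun γ => ⟨fun h => ?_, fun h => ?_⟩
    · refine smul_eq_of_fixes (origin_mem_orbit Γ) hspan fun z hz => ?_
      refine Subtype.ext (PiLp.ext fun j => ?_)
      -- The generators are the coordinate functions, which separate points.
      have h1 := hτ γ (quotMap (orbit Γ) (gen j : HardyAlg n)) z hz
      rwa [h, AlgEquiv.one_apply, quotEval_quotMap, quotEval_quotMap, evalAt_gen,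
        evalAt_gen] at h1
    · refine AlgEquiv.ext fun a => quotAlg_ext fun z hz => ?_
      rw [AlgEquiv.one_apply, ← hτ γ a z hz]
      exact quotEval_congr (h z).symm _ _ _
  · intro a ha
    -- The scalar is the value at 0; invariance under γ carries it to γ(0).
    refine ⟨quotEval _ (origin_mem_orbit Γ) a, quotAlg_ext ?_⟩
    rintro _ ⟨γ, rfl⟩
    have h1 := hτ ⟨γ.1, le_orbitStabilizer Γ γ.2⟩ a _ (origin_mem_orbit Γ)
    rw [ha γ.1 γ.2] at h1
    rw [AlgHom.commutes]
    exact h1
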